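/- Let $\ell$ be a prime number and let $K_v$ be a field of characteristic $0$, complete for a discrete valuation $v$ normalized by $v(K_v^{\times})=\mathbb{Z}$, whose residue field is perfect of characteristic $\ell$. Let $e=v(\ell)$ be its absolute ramification index, and let $|x|=\ell^{-v(x)}$ be the associated absolute value, extended (uniquely) to the algebraic extensions of $K_v$. Let $K_\infty/K_v$ be a totally ramified Galois extension with $\mathrm{Gal}(K_\infty/K_v)\simeq\mathbb{Z}_\ell$ (as topological groups), let $\sigma$ be a topological generator of this group, and for $n\ge 0$ let $K_n\subset K_\infty$ be the subfield fixed by the subgroup $\ell^n\mathbb{Z}_\ell$. Then $K_\infty=\bigcup_n K_n$, and for $x\in K_\infty$ the normalized trace $$t(x)=\ell^{-n}\,\mathrm{Tr}_{K_n/K_v}(x)\in K_v\qquad (x\in K_n)$$ does not depend on the choice of $n$ with $x\in K_n$. Moreover, there is a real number $c_5$ with $$|c_5|\le \frac{2\ell}{(\ell-1)^2}e^2+e+\frac{1}{\ell(\ell-1)}\le 6e^2$$ such that for every $x\in K_\infty$ $$|x-t(x)|\le \ell^{c_5}\,|x-\sigma(x)|.$$ -/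

import Mathlib

noncomputable section

/-- The ring of integers `{x | ‖x‖ ≤ 1}` of an ultrametric normed field. -/
abbrev integerRing (K : Type*) [NormedField K] [IsUltrametricDist K] : ValuationSubring K :=
  (NormedField.valuation (K := K)).valuationSubring

/-- `K` is a local field of residue characteristic `ℓ` in the broad sense: complete for a discrete
valuation `v`, with perfect residue field of characteristic `ℓ`. The valuation is normalized by
`v(Kˣ) = ℤ`, and the absolute value of `K` is the associated one, `‖x‖ = ℓ ^ (-v x)`. -/
structure IsNormalizedLocalField (ℓ : ℕ) (K : Type*) [NormedField K] [IsUltrametricDist K] :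
    Prop where
  complete : CompleteSpace K
  norm_eq_zpow : ∀ x : K, x ≠ 0 → ∃ k : ℤ, ‖x‖ = (ℓ : ℝ) ^ k
  exists_uniformizer : ∃ ϖ : K, ‖ϖ‖ = (ℓ : ℝ)⁻¹
  residue_char : CharP (IsLocalRing.ResidueField (integerRing K)) ℓ
  residue_perfect : PerfectField (IsLocalRing.ResidueField (integerRing K))

section Extension

variable (K L : Type*) [NormedField K] [Field L] [Algebra K L]

/-- The algebraic extension `L` of the local field `K` is totally ramified: it has the same residue
field as `K`, i.e. every integer of `L` is congruent to an element of `K` modulo the maximal ideal.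
Here `spectralNorm K L` is the unique absolute value of `L` extending that of `K`. -/
def IsTotallyRamifiedExt : Prop :=
  ∀ x : L, spectralNorm K L x ≤ 1 → ∃ y : K, spectralNorm K L (x - algebraMap K L y) < 1

/-- For `Gal(L/K) ≃ ℤ_ℓ`: the subfield `K_n` of `L` fixed by the subgroup `ℓ ^ n ℤ_ℓ`
(the subgroup of `ℓ ^ n`-th powers in the Galois group, written multiplicatively). -/
def layer (ℓ n : ℕ) : IntermediateField K L :=
  IntermediateField.fixedField
    (Subgroup.closure (Set.range fun τ : L ≃ₐ[K] L => τ ^ (ℓ ^ n)))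

variable {L}

open Classical in
/-- The normalized trace `t(x) = ℓ ^ (-n) Tr_{K_n/K}(x)`, with `n` the least integer such that
`x ∈ K_n` (any other `n` with `x ∈ K_n` gives the same value). -/
def normalizedTrace (ℓ : ℕ) (x : L) : K :=
  if h : ∃ n : ℕ, x ∈ layer K L ℓ n then
    ((ℓ : K) ^ Nat.find h)⁻¹ * Algebra.trace K (layer K L ℓ (Nat.find h)) ⟨x, Nat.find_spec h⟩
  else 0

end Extension

end

/-! The normalized trace is a composite of averages `ℓ⁻¹ (1 + s + ⋯ + s ^ (ℓ - 1))`, with `s = σ ^ ℓ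
^ n`, from layer `n + 1` to layer `n`. One average moves `x` by at most `‖ℓ‖⁻¹ ‖x - σ x‖`
(`norm_sub_trace_step`), but it may enlarge the quantity `‖x - σ x‖` handed to the next one. If `s -
1` contracts layer `n + 1` by `ρₙ = ℓ ^ (-αₙ)`, the congruence of `1 + s + ⋯ + s ^ (ℓ - 1)` with `(s
- 1) ^ (ℓ - 1)` modulo `ℓ` bounds this enlargement by `ℓ ^ δₙ`, where `δₙ = max 0 (e - (ℓ - 1) αₙ)`
(`norm_trace_step_sub`). The constant is therefore `e + ∑ δₙ` over `n ≥ 1`, and the sum has to be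
bounded independently of the height.

This is a statement about the growth of ramification: `contraction_pow_le` gives `ℓ αₙ₊₁ ≥ αₙ + min
(ℓ (ℓ - 1) αₙ) e` as long as `(ℓ - 1) αₙ₊₁ < e`, and `sum_ramification_deficit_le` sums the deficits
from this recursion and `ℓ α₀ ≥ 1`.

The growth is proved with elements, without upper numbering or class field theory. For two
consecutive steps with generators `s` and `t = s ^ ℓ`, norms of principal units bound the
contraction of `s` on the upper layer (`pow_contraction_le`). Then one takes `y` with `(t - 1) y` a
unit, factors `t - 1` as `(1 + s + ⋯ + s ^ (ℓ - 1)) (s - 1)`, and splits `(s - 1) y` into a part in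
the middle layer and a part far from it; one of the two must have a large trace. -/

/-! ### Isometric endomorphisms of ultrametric fields. -/

section Ultrametric

variable {F : Type*} [NormedField F]

/-- The endomorphism `x ↦ s x - x`. -/
noncomputable def diffEnd (s : F →+* F) : Module.End ℤ F := s.toAddMonoidHom.toIntLinearMap - 1

@[simp]
theorem diffEnd_apply (s : F →+* F) (x : F) : diffEnd s x = s x - x := rfl

theorem geom_sum_apply_diff (s : F →+* F) (n : ℕ) (x : F) :
    ∑ i ∈ Finset.range n, (s ^ i) (s x - x) = (s ^ n) x - x := by
  have : ∀ i, (s ^ i) (s x - x) = (s ^ (i + 1)) x - (s ^ i) x := by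
    intro i; rw [map_sub, pow_succ]; rfl
  simp_rw [this, Finset.sum_range_sub (fun i => (s ^ i) x)]
  simp

theorem norm_pow_apply {s : F →+* F} (hs : ∀ x, ‖s x‖ = ‖x‖) (k : ℕ) (x : F) :
    ‖(s ^ k) x‖ = ‖x‖ := by
  induction k with
  | zero => simp
  | succ k ih => rw [pow_succ', RingHom.mul_def, RingHom.comp_apply, hs, ih]

variable [IsUltrametricDist F]

theorem norm_add_le_of_ultrametric {x y : F} {r : ℝ} (hx : ‖x‖ ≤ r) (hy : ‖y‖ ≤ r) :
    ‖x + y‖ ≤ r :=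
  (IsUltrametricDist.norm_add_le_max x y).trans (max_le hx hy)

theorem norm_sub_le_of_ultrametric {x y : F} {r : ℝ} (hx : ‖x‖ ≤ r) (hy : ‖y‖ ≤ r) :
    ‖x - y‖ ≤ r := by
  rw [sub_eq_add_neg]
  exact norm_add_le_of_ultrametric hx (by rwa [norm_neg])

theorem norm_sum_le_of_ultrametric {ι : Type*} (s : Finset ι) (f : ι → F) {r : ℝ} (hr : 0 ≤ r)
    (h : ∀ i ∈ s, ‖f i‖ ≤ r) : ‖∑ i ∈ s, f i‖ ≤ r := by
  classical
  induction s using Finset.induction_on with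
  | empty => simpa using hr
  | insert a s ha ih =>
    rw [Finset.sum_insert ha]
    exact norm_add_le_of_ultrametric (h a (by simp)) (ih fun i hi => h i (by simp [hi]))

theorem norm_add_eq_left_of_lt {x y : F} (h : ‖y‖ < ‖x‖) : ‖x + y‖ = ‖x‖ := by
  rw [IsUltrametricDist.norm_add_eq_max_of_norm_ne_norm h.ne', max_eq_left h.le]

theorem norm_natCast_le_one_of_ultrametric (n : ℕ) : ‖(n : F)‖ ≤ 1 :=
  IsUltrametricDist.norm_natCast_le_one F n

/-- Products of elements close to elements of norm at most `1`. -/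
theorem norm_prod_sub_prod_le {ι : Type*} (s : Finset ι) (f g : ι → F) {r : ℝ} (hr : 0 ≤ r)
    (hf : ∀ i ∈ s, ‖f i‖ ≤ 1) (hg : ∀ i ∈ s, ‖g i‖ ≤ 1) (h : ∀ i ∈ s, ‖f i - g i‖ ≤ r) :
    ‖∏ i ∈ s, f i - ∏ i ∈ s, g i‖ ≤ r := by
  classical
  induction s using Finset.induction_on with
  | empty => simpa using hr
  | insert a s ha ih =>
    rw [Finset.prod_insert ha, Finset.prod_insert ha]
    have e : f a * ∏ i ∈ s, f i - g a * ∏ i ∈ s, g i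
      = (f a - g a) * ∏ i ∈ s, f i + g a * (∏ i ∈ s, f i - ∏ i ∈ s, g i) := by ring
    rw [e]
    refine norm_add_le_of_ultrametric ?_ ?_
    · rw [norm_mul, norm_prod]
      refine (mul_le_mul (h a (by simp)) (Finset.prod_le_one (fun i _ => norm_nonneg _)
        fun i hi => hf i (by simp [hi])) (Finset.prod_nonneg fun i _ => norm_nonneg _) hr).trans ?_
      rw [mul_one]
    · rw [norm_mul]
      have := ih (fun i hi => hf i (by simp [hi])) (fun i hi => hg i (by simp [hi]))
        (fun i hi => h i (by simp [hi]))
      calc ‖g a‖ * _ ≤ 1 * r := mul_le_mul (hg a (by simp)) this (norm_nonneg _) zero_le_one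
        _ = r := one_mul r

open Polynomial in
theorem norm_aeval_end_apply_le (φ : Module.End ℤ F) (hφ : ∀ x, ‖φ x‖ ≤ ‖x‖) (R : ℤ[X]) (x : F) :
    ‖aeval φ R x‖ ≤ ‖x‖ := by
  have hpow : ∀ (n : ℕ), ‖(φ ^ n) x‖ ≤ ‖x‖ := by
    intro n
    induction n with
    | zero => simp
    | succ n ih => rw [pow_succ', Module.End.mul_apply]; exact (hφ _).trans ih
  induction R using Polynomial.induction_on' with
  | add p q hp hq => rw [map_add, LinearMap.add_apply]; exact norm_add_le_of_ultrametric hp hq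
  | monomial n a =>
    rw [aeval_monomial, Module.End.mul_apply, eq_intCast (algebraMap ℤ (Module.End ℤ F)) a]
    have : ((a : Module.End ℤ F)) ((φ ^ n) x) = (a : F) * (φ ^ n) x := by
      rw [Module.End.intCast_apply, zsmul_eq_mul]
    rw [this, norm_mul]
    calc _ ≤ 1 * ‖x‖ := mul_le_mul (IsUltrametricDist.norm_intCast_le_one F a) (hpow n)
            (norm_nonneg _) zero_le_one
      _ = ‖x‖ := one_mul _

-- After multiplication by `X` the left side becomes `(1 + X) ^ ℓ - 1`, so this is the divisibility
-- of the binomial coefficients by `ℓ`.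
open Polynomial in
theorem exists_geom_sum_one_add_X (ℓ : ℕ) [Fact ℓ.Prime] :
    ∃ R : ℤ[X], ∑ i ∈ Finset.range ℓ, (1 + X : ℤ[X]) ^ i = X ^ (ℓ - 1) + (ℓ : ℤ[X]) * R := by
  obtain ⟨R, hR⟩ := exists_add_pow_prime_eq (Fact.out : ℓ.Prime) (1 : ℤ[X]) X
  refine ⟨R, mul_right_cancel₀ (X_ne_zero (R := ℤ)) ?_⟩
  have h1 := geom_sum_mul (1 + X : ℤ[X]) ℓ
  rw [add_sub_cancel_left] at h1
  have h2 : (X : ℤ[X]) ^ ℓ = X ^ (ℓ - 1) * X := by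
    rw [← pow_succ, Nat.sub_add_cancel (Fact.out : ℓ.Prime).one_le]
  rw [h1, hR, h2, one_pow]
  ring

theorem norm_diffEnd_le {s : F →+* F} (hs : ∀ x, ‖s x‖ = ‖x‖) (x : F) : ‖diffEnd s x‖ ≤ ‖x‖ :=
  norm_sub_le_of_ultrametric (hs x).le le_rfl

open Polynomial in
/-- `1 + s + ⋯ + s ^ (ℓ - 1) = (s - 1) ^ (ℓ - 1) + ℓ R(s - 1)`. -/
theorem exists_geom_sum_apply_eq (ℓ : ℕ) [Fact ℓ.Prime] {s : F →+* F} (hs : ∀ x, ‖s x‖ = ‖x‖)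
    (x : F) : ∃ w : F, ∑ i ∈ Finset.range ℓ, (s ^ i) x = (diffEnd s ^ (ℓ - 1)) x + ℓ * w ∧
      ‖w‖ ≤ ‖x‖ := by
  obtain ⟨R, hR⟩ := exists_geom_sum_one_add_X ℓ
  refine ⟨aeval (diffEnd s) R x, ?_, norm_aeval_end_apply_le _ (norm_diffEnd_le hs) R x⟩
  have h := congrArg (fun P => aeval (diffEnd s) P x) hR
  have hs1 : aeval (diffEnd s) (1 + X : ℤ[X]) = s.toAddMonoidHom.toIntLinearMap := by
    simp [diffEnd]
  simp only [map_sum, map_pow, map_add, map_mul, hs1, aeval_X, map_natCast, LinearMap.sum_apply,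
    LinearMap.add_apply, Module.End.mul_apply, Module.End.natCast_apply, nsmul_eq_mul] at h
  rw [← h]
  refine Finset.sum_congr rfl fun i _ => ?_
  rw [Module.End.pow_apply, RingHom.coe_pow]
  rfl

/-- If `h ^ ℓ` is a principal unit and `ℓ` is topologically nilpotent then `h` is a principal
unit. -/
theorem norm_sub_one_lt_of_pow (ℓ : ℕ) [Fact ℓ.Prime] (hq : ‖(ℓ : F)‖ < 1) {h : F}
    (hh : ‖h‖ ≤ 1) (hp : ‖h ^ ℓ - 1‖ < 1) : ‖h - 1‖ < 1 := by
  have hl := (Fact.out : ℓ.Prime)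
  let A : Subring F :=
    { carrier := {x | ‖x‖ ≤ 1}
      mul_mem' := fun {a b} ha hb => by
        simp only [Set.mem_ofPred_eq, norm_mul] at *; exact mul_le_one₀ ha (norm_nonneg _) hb
      one_mem' := by simp
      add_mem' := fun ha hb => norm_add_le_of_ultrametric ha hb
      zero_mem' := by simp
      neg_mem' := fun {a} ha => by simpa using ha }
  obtain ⟨r, hr⟩ := exists_add_pow_prime_eq hl (1 : A)
    (⟨h - 1, norm_sub_le_of_ultrametric hh (by simp)⟩ : A)
  have hr' := congrArg (fun a : A => (a : F)) hr
  simp only [Subring.coe_pow, Subring.coe_add, Subring.coe_mul, Subring.coe_one, one_pow,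
    add_sub_cancel, Subring.coe_natCast, mul_one] at hr'
  have e : (h - 1) ^ ℓ = (h ^ ℓ - 1) - ℓ * ((h - 1) * r) := by rw [hr']; ring
  have hh1 : ‖h - 1‖ ≤ 1 := norm_sub_le_of_ultrametric hh (by simp)
  have h2 : ‖(ℓ : F) * ((h - 1) * r)‖ < 1 := by
    rw [norm_mul, norm_mul]
    refine lt_of_le_of_lt ?_ hq
    have : ‖h - 1‖ * ‖(r : F)‖ ≤ 1 := mul_le_one₀ hh1 (norm_nonneg _) r.2
    exact mul_le_of_le_one_right (norm_nonneg _) this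
  by_contra! hc
  have h3 : 1 ≤ ‖(h - 1) ^ ℓ‖ := by rw [norm_pow]; exact one_le_pow₀ hc
  rw [e, sub_eq_add_neg] at h3
  have := IsUltrametricDist.norm_add_le_max (h ^ ℓ - 1) (-(ℓ * ((h - 1) * (r : F))))
  rw [norm_neg] at this
  exact absurd (h3.trans this) (not_le.2 (max_lt hp h2))

theorem norm_aeval_le_one {β : F} (hβ : ‖β‖ ≤ 1) (R : Polynomial ℤ) :
    ‖Polynomial.aeval β R‖ ≤ 1 := by
  induction R using Polynomial.induction_on' with
  | add p q hp hq => rw [map_add]; exact norm_add_le_of_ultrametric hp hq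
  | monomial n a =>
    rw [Polynomial.aeval_monomial, eq_intCast (algebraMap ℤ F) a, norm_mul, norm_pow]
    exact mul_le_one₀ (IsUltrametricDist.norm_intCast_le_one F a) (by positivity)
      (pow_le_one₀ (norm_nonneg _) hβ)

/-- `‖(1 + β) ^ ℓ - 1‖ = ‖β‖ ^ ℓ` as soon as `‖ℓ‖ < ‖β‖ ^ (ℓ - 1)`. -/
theorem norm_one_add_pow_sub_one (ℓ : ℕ) [Fact ℓ.Prime] {β : F} (hβ : ‖β‖ ≤ 1)
    (hq : ‖(ℓ : F)‖ < ‖β‖ ^ (ℓ - 1)) : ‖(1 + β) ^ ℓ - 1‖ = ‖β‖ ^ ℓ := by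
  have hl := (Fact.out : ℓ.Prime)
  obtain ⟨R, hR⟩ := exists_geom_sum_one_add_X ℓ
  have h1 := congrArg (Polynomial.aeval β) hR
  simp only [map_sum, map_pow, map_add, map_mul, Polynomial.aeval_X, map_natCast, map_one] at h1
  have h2 := geom_sum_mul (1 + β) ℓ
  rw [add_sub_cancel_left, h1] at h2
  have hRn := norm_aeval_le_one hβ R
  rw [← h2, norm_mul, norm_add_eq_left_of_lt, norm_pow, ← pow_succ, Nat.sub_add_cancel hl.one_le]
  rw [norm_mul, norm_pow]
  exact (mul_le_of_le_one_right (norm_nonneg _) hRn).trans_lt hq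

end Ultrametric

/-! ### Value groups and contraction ratios in a totally ramified tower. -/

section Tower

/-- The subfield of elements fixed by `σ ^ (ℓ ^ n)`. -/
def fixedLayer {F : Type*} [Field F] (σ : F →+* F) (ℓ n : ℕ) : Subfield F :=
  (σ ^ (ℓ ^ n)).eqLocusField (RingHom.id F)

/-- The tower of the fields `fixedLayer σ ℓ n` is a totally ramified `ℤ_ℓ`-tower over the discretely
valued field of the elements fixed by `σ`, with absolute ramification index `e`. -/
structure IsRamifiedTower {F : Type*} [NormedField F] (ℓ e : ℕ) (σ : F →+* F) : Prop where
  isometry : ∀ x, ‖σ x‖ = ‖x‖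
  norm_eq_zpow : ∀ x, σ x = x → x ≠ 0 → ∃ k : ℤ, ‖x‖ = (ℓ : ℝ) ^ k
  exists_uniformizer : ∃ ϖ, σ ϖ = ϖ ∧ ‖ϖ‖ = (ℓ : ℝ)⁻¹
  exists_residue : ∀ x, ‖x‖ ≤ 1 → ∃ y, σ y = y ∧ ‖x - y‖ < 1
  strict : ∀ n, ∃ x, x ∈ fixedLayer σ ℓ (n + 1) ∧ x ∉ fixedLayer σ ℓ n
  norm_natCast : ‖(ℓ : F)‖ = (ℓ : ℝ) ^ (-(e : ℤ))
  index_pos : 0 < e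

/-- The value group of the `n`-th layer. -/
def IsLayerValue (ℓ n : ℕ) (r : ℝ) : Prop := ∃ k : ℤ, r ^ (ℓ ^ n) = (ℓ : ℝ) ^ k

/-- `ρ` is the contraction ratio of `σ ^ (ℓ ^ n) - 1` on the layer `n + 1`; it measures the
ramification of the `n`-th step of the tower. -/
structure IsStepContraction {F : Type*} [NormedField F] (ℓ : ℕ) (σ : F →+* F) (n : ℕ) (ρ : ℝ) :
    Prop where
  pos : 0 < ρ
  lt_one : ρ < 1
  isLayerValue : IsLayerValue ℓ (n + 1) ρ
  norm_le : ∀ x ∈ fixedLayer σ ℓ (n + 1), ‖(σ ^ ℓ ^ n) x - x‖ ≤ ρ * ‖x‖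
  norm_eq : ∀ x ∈ fixedLayer σ ℓ (n + 1), x ≠ 0 → ¬ IsLayerValue ℓ n ‖x‖ →
    ‖(σ ^ ℓ ^ n) x - x‖ = ρ * ‖x‖

theorem mem_fixedLayer {F : Type*} [Field F] {σ : F →+* F} {ℓ n : ℕ} {x : F} :
    x ∈ fixedLayer σ ℓ n ↔ (σ ^ (ℓ ^ n)) x = x := Iff.rfl

theorem mem_fixedLayer_zero {F : Type*} [Field F] {σ : F →+* F} {ℓ : ℕ} {x : F} :
    x ∈ fixedLayer σ ℓ 0 ↔ σ x = x := by
  rw [mem_fixedLayer, pow_zero, pow_one]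

theorem RingHom.pow_mul_apply_eq_self {F : Type*} [Field F] {s : F →+* F} {x : F} {k : ℕ}
    (h : (s ^ k) x = x) (j : ℕ) : (s ^ (k * j)) x = x := by
  rw [pow_mul]
  generalize s ^ k = t at h
  induction j with
  | zero => simp
  | succ j ih => rw [pow_succ, RingHom.mul_def, RingHom.comp_apply, h, ih]

theorem fixedLayer_mono {F : Type*} [Field F] {σ : F →+* F} {ℓ m n : ℕ} (h : m ≤ n) :
    fixedLayer σ ℓ m ≤ fixedLayer σ ℓ n := by
  intro x hx
  obtain ⟨j, rfl⟩ := Nat.exists_eq_add_of_le h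
  rw [mem_fixedLayer, pow_add]
  exact RingHom.pow_mul_apply_eq_self hx _

theorem RingHom.pow_pow_comm_apply {F : Type*} [Field F] (s : F →+* F) (i j : ℕ) (x : F) :
    (s ^ i) ((s ^ j) x) = (s ^ j) ((s ^ i) x) := by
  rw [← RingHom.comp_apply, ← RingHom.mul_def, ← pow_add, add_comm, pow_add]; rfl

theorem pow_apply_mem_fixedLayer {F : Type*} [Field F] {σ : F →+* F} {ℓ n : ℕ} {x : F}
    (hx : x ∈ fixedLayer σ ℓ n) (j : ℕ) : (σ ^ j) x ∈ fixedLayer σ ℓ n := by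
  rw [mem_fixedLayer] at *
  rw [RingHom.pow_pow_comm_apply, hx]

theorem RingHom.pow_apply_eq_self {F : Type*} [Field F] {s : F →+* F} {x : F}
    (h : s x = x) (j : ℕ) : (s ^ j) x = x := by
  have := RingHom.pow_mul_apply_eq_self (k := 1) (s := s) (by rwa [pow_one]) j
  rwa [one_mul] at this

theorem RingHom.pow_apply_sub_eq {F : Type*} [Field F] {s : F →+* F} {y a : F} (ha : s a = a)
    (j : ℕ) : (s ^ j) y - y = (s ^ j) (y - a) - (y - a) := by
  rw [map_sub, RingHom.pow_apply_eq_self ha]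
  ring

theorem map_sum_range_pow {F : Type*} [Field F] {s : F →+* F} {x : F} {k : ℕ}
    (h : (s ^ k) x = x) :
    s (∑ i ∈ Finset.range k, (s ^ i) x) = ∑ i ∈ Finset.range k, (s ^ i) x := by
  have h1 : ∀ i, s ((s ^ i) x) = (s ^ (i + 1)) x := fun i => by rw [pow_succ']; rfl
  rw [map_sum]
  simp_rw [h1]
  have h2 := Finset.sum_range_succ (fun i => (s ^ i) x) k
  rw [Finset.sum_range_succ', h] at h2
  simpa using h2

theorem map_prod_range_pow {F : Type*} [Field F] {s : F →+* F} {x : F} {k : ℕ}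
    (h : (s ^ k) x = x) :
    s (∏ i ∈ Finset.range k, (s ^ i) x) = ∏ i ∈ Finset.range k, (s ^ i) x := by
  rcases eq_or_ne x 0 with rfl | hx
  · simp
  have h1 : ∀ i, s ((s ^ i) x) = (s ^ (i + 1)) x := fun i => by rw [pow_succ']; rfl
  rw [map_prod]
  simp_rw [h1]
  have h2 := Finset.prod_range_succ (fun i => (s ^ i) x) k
  rw [Finset.prod_range_succ', h] at h2
  simpa [hx] using h2

/-- Being moved by less than the ratio `ρ` is multiplicative, by the twisted Leibniz rule. It can
therefore be tested on factors of an element. -/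
theorem exists_subgroup_norm_sub_lt {F : Type*} [NormedField F] [IsUltrametricDist F] {s : F →+* F}
    (hs : ∀ x, ‖s x‖ = ‖x‖) {ρ : ℝ} (hρ : 0 < ρ) :
    ∃ H : Subgroup Fˣ, ∀ z : Fˣ, z ∈ H ↔ ‖s z - z‖ < ρ * ‖(z : F)‖ := by
  refine ⟨{ carrier := {z | ‖s z - z‖ < ρ * ‖(z : F)‖}
            mul_mem' := ?_
            one_mem' := ?_
            inv_mem' := ?_ }, fun z => Iff.rfl⟩
  · intro z w hz hw
    simp only [Set.mem_ofPred_eq, Units.val_mul, map_mul, norm_mul] at *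
    have hz0 : 0 < ‖(z : F)‖ := norm_pos_iff.2 z.ne_zero
    have hw0 : 0 < ‖(w : F)‖ := norm_pos_iff.2 w.ne_zero
    have e : s z * s w - z * w = (s z - z) * s w + z * (s w - w) := by ring
    rw [e]
    refine (IsUltrametricDist.norm_add_le_max _ _).trans_lt (max_lt ?_ ?_)
    · rw [norm_mul, hs, ← mul_assoc]
      exact mul_lt_mul_of_pos_right hz hw0
    · rw [norm_mul]
      calc ‖(z : F)‖ * ‖s w - w‖ < ‖(z : F)‖ * (ρ * ‖(w : F)‖) := mul_lt_mul_of_pos_left hw hz0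
        _ = _ := by ring
  · simpa using hρ
  · intro z hz
    simp only [Set.mem_ofPred_eq, Units.val_inv_eq_inv_val, map_inv₀, norm_inv] at *
    have hz0 : 0 < ‖(z : F)‖ := norm_pos_iff.2 z.ne_zero
    have hsz : s z ≠ 0 := by rw [← norm_pos_iff, hs]; exact hz0
    have e : (s z)⁻¹ - (z : F)⁻¹ = (z - s z) / (s z * z) := by
      have := z.ne_zero
      field_simp
    rw [e, norm_div, norm_mul, hs, norm_sub_rev, div_lt_iff₀ (by positivity)]
    calc _ < ρ * ‖(z : F)‖ := hz
      _ = _ := by field_simp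

namespace IsLayerValue

variable {ℓ n : ℕ}

theorem div {r t : ℝ} (hr : IsLayerValue ℓ n r) (ht : IsLayerValue ℓ n t) (h : ℓ ≠ 0) :
    IsLayerValue ℓ n (r / t) := by
  obtain ⟨a, ha⟩ := hr
  obtain ⟨b, hb⟩ := ht
  exact ⟨a - b, by rw [div_pow, ha, hb, zpow_sub₀ (by exact_mod_cast h)]⟩

theorem mul {r t : ℝ} (hr : IsLayerValue ℓ n r) (ht : IsLayerValue ℓ n t) (h : ℓ ≠ 0) :
    IsLayerValue ℓ n (r * t) := by
  obtain ⟨a, ha⟩ := hr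
  obtain ⟨b, hb⟩ := ht
  exact ⟨a + b, by rw [mul_pow, ha, hb, zpow_add₀ (by exact_mod_cast h)]⟩

theorem zpow {r : ℝ} (hr : IsLayerValue ℓ n r) (a : ℤ) : IsLayerValue ℓ n (r ^ a) := by
  obtain ⟨b, hb⟩ := hr
  refine ⟨b * a, ?_⟩
  rw [← zpow_natCast, ← zpow_mul, mul_comm a, zpow_mul, zpow_natCast, hb, ← zpow_mul]

/-- The value group of a layer has prime index in the next one. -/
theorem exists_div_zpow [Fact ℓ.Prime] {r t : ℝ} (hr : 0 < r) (ht : 0 < t)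
    (hr1 : IsLayerValue ℓ (n + 1) r) (ht1 : IsLayerValue ℓ (n + 1) t)
    (htn : ¬ IsLayerValue ℓ n t) : ∃ a : ℤ, IsLayerValue ℓ n (r / t ^ a) := by
  have hl := (Fact.out : ℓ.Prime)
  have root : ∀ {x : ℝ} {b : ℤ}, 0 < x → x ^ (ℓ ^ (n + 1)) = (ℓ : ℝ) ^ (b * ℓ) →
      IsLayerValue ℓ n x := by
    intro x b hx h
    refine ⟨b, (pow_left_inj₀ (by positivity) (by positivity) hl.ne_zero).1 ?_⟩
    rw [← pow_mul, ← pow_succ, h, zpow_mul, zpow_natCast]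
  obtain ⟨k, hk⟩ := hr1
  obtain ⟨k₀, hk₀⟩ := ht1
  have hnd : ¬ (ℓ : ℤ) ∣ k₀ := by
    rintro ⟨b, rfl⟩
    exact htn (root ht (by rw [hk₀, mul_comm]))
  obtain ⟨u, v, huv⟩ := ((Nat.prime_iff_prime_int.1 hl).coprime_iff_not_dvd).2 hnd
  refine ⟨v * k, root (b := u * k) (by positivity) ?_⟩
  have e : k = u * k * ℓ + k₀ * (v * k) := by linear_combination (-k) * huv
  have hl0 : (ℓ : ℝ) ≠ 0 := by exact_mod_cast hl.ne_zero
  rw [div_pow, hk, ← zpow_natCast (t ^ (v * k)), ← zpow_mul, mul_comm (v * k), zpow_mul,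
    zpow_natCast, hk₀, ← zpow_mul, ← zpow_sub₀ hl0]
  congr 1
  linear_combination e

theorem not_zpow [Fact ℓ.Prime] {t : ℝ} (ht : 0 < t) (ht1 : IsLayerValue ℓ (n + 1) t)
    (htn : ¬ IsLayerValue ℓ n t) {i : ℤ} (hi : ¬ (ℓ : ℤ) ∣ i) : ¬ IsLayerValue ℓ n (t ^ i) := by
  have hl := (Fact.out : ℓ.Prime)
  intro h
  obtain ⟨u, v, huv⟩ := ((Nat.prime_iff_prime_int.1 hl).coprime_iff_not_dvd).2 hi
  have h1 : IsLayerValue ℓ n (t ^ (ℓ : ℤ)) := by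
    obtain ⟨k, hk⟩ := ht1
    exact ⟨k, by rw [zpow_natCast, ← pow_mul, ← pow_succ', hk]⟩
  apply htn
  have e : t = (t ^ (ℓ : ℤ)) ^ u * (t ^ i) ^ v := by
    rw [← zpow_mul, ← zpow_mul, ← zpow_add₀ ht.ne', mul_comm (ℓ : ℤ), mul_comm i, huv, zpow_one]
  rw [e]
  exact (h1.zpow u).mul (h.zpow v) hl.ne_zero

end IsLayerValue

namespace IsRamifiedTower

variable {F : Type*} [NormedField F] {ℓ e : ℕ} {σ : F →+* F}

theorem norm_pow (T : IsRamifiedTower ℓ e σ) (j : ℕ) (x : F) : ‖(σ ^ j) x‖ = ‖x‖ :=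
  norm_pow_apply T.isometry j x

theorem isLayerValue_norm (T : IsRamifiedTower ℓ e σ) {n : ℕ} {x : F}
    (hx : x ∈ fixedLayer σ ℓ n) (h0 : x ≠ 0) : IsLayerValue ℓ n ‖x‖ := by
  obtain ⟨k, hk⟩ := T.norm_eq_zpow _ (map_prod_range_pow (mem_fixedLayer.1 hx))
    (Finset.prod_ne_zero_iff.2 fun i _ => (map_ne_zero _).2 h0)
  refine ⟨k, ?_⟩
  rw [← hk, norm_prod, Finset.prod_congr rfl fun i _ => T.norm_pow i x, Finset.prod_const,
    Finset.card_range]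

variable [Fact ℓ.Prime]

theorem norm_natCast_pos (T : IsRamifiedTower ℓ e σ) : 0 < ‖(ℓ : F)‖ := by
  have := (Fact.out : ℓ.Prime).pos
  rw [T.norm_natCast]
  positivity

theorem norm_natCast_lt_one (T : IsRamifiedTower ℓ e σ) : ‖(ℓ : F)‖ < 1 := by
  rw [T.norm_natCast, zpow_neg, zpow_natCast]
  exact inv_lt_one_of_one_lt₀ (one_lt_pow₀ (by exact_mod_cast (Fact.out : ℓ.Prime).one_lt)
    T.index_pos.ne')

variable [IsUltrametricDist F]

/-- The action on the value group is trivial and the tower is wild: `σ ^ j` moves every element to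
a multiple by a principal unit. -/
theorem norm_pow_apply_sub_lt (T : IsRamifiedTower ℓ e σ) {m : ℕ} {x : F}
    (hx : x ∈ fixedLayer σ ℓ m) (h0 : x ≠ 0) (j : ℕ) : ‖(σ ^ j) x - x‖ < ‖x‖ := by
  have iter : ∀ (m : ℕ) (h : F), ‖h‖ ≤ 1 → ‖h ^ (ℓ ^ m) - 1‖ < 1 → ‖h - 1‖ < 1 := by
    intro m
    induction m with
    | zero => intro h _ h2; simpa using h2
    | succ m ih =>
      intro h h1 h2
      refine ih h h1 (norm_sub_one_lt_of_pow ℓ T.norm_natCast_lt_one ?_ ?_)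
      · rw [_root_.norm_pow]; exact pow_le_one₀ (norm_nonneg _) h1
      · rwa [← pow_mul, ← pow_succ]
  have hx0 : 0 < ‖x‖ := norm_pos_iff.2 h0
  set b := ∏ i ∈ Finset.range (ℓ ^ m), (σ ^ i) x with hb
  have hbσ : σ b = b := map_prod_range_pow (mem_fixedLayer.1 hx)
  have hbn : ‖b‖ = ‖x‖ ^ (ℓ ^ m) := by
    rw [hb, norm_prod, Finset.prod_congr rfl fun i _ => T.norm_pow i x, Finset.prod_const,
      Finset.card_range]
  have hb0 : b ≠ 0 := by rw [← norm_pos_iff, hbn]; positivity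
  -- Here `b` is the norm of `x` to the base, so `u` is a unit; its residue comes from the base,
  -- hence `σ ^ j` moves it by a principal unit. Extracting `ℓ`-th roots `m` times brings this back
  -- to `x`.
  set u := x ^ (ℓ ^ m) / b with hu
  have hu1 : ‖u‖ = 1 := by
    rw [hu, norm_div, hbn, _root_.norm_pow, div_self (by positivity)]
  obtain ⟨a, ha, hua⟩ := T.exists_residue u hu1.le
  have h1 : ‖(σ ^ j) u - u‖ < 1 := by
    rw [RingHom.pow_apply_sub_eq ha]
    exact (norm_sub_le_of_ultrametric (T.norm_pow j _).le le_rfl).trans_lt hua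
  have h2 : ‖(σ ^ j) x / x - 1‖ < 1 := by
    refine iter m _ ?_ ?_
    · rw [norm_div, T.norm_pow, div_self hx0.ne']
    · have hu0 : u ≠ 0 := by rw [← norm_pos_iff, hu1]; exact one_pos
      have e : ((σ ^ j) x / x) ^ ℓ ^ m - 1 = ((σ ^ j) u - u) / u := by
        rw [sub_div, div_self hu0, hu, map_div₀, map_pow, RingHom.pow_apply_eq_self hbσ, div_pow]
        field_simp
      rw [e, norm_div, hu1, div_one]
      exact h1
  have e : (σ ^ j) x - x = ((σ ^ j) x / x - 1) * x := by field_simp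
  rw [e, norm_mul]
  exact mul_lt_of_lt_one_left hx0 h2

/-- The contraction ratio of `σ ^ j - 1` on a layer is attained. -/
theorem exists_maximal_contraction (T : IsRamifiedTower ℓ e σ) (m j : ℕ) :
    ∃ x ∈ fixedLayer σ ℓ m, x ≠ 0 ∧
      ∀ y ∈ fixedLayer σ ℓ m, ‖(σ ^ j) y - y‖ * ‖x‖ ≤ ‖(σ ^ j) x - x‖ * ‖y‖ := by
  have hl := (Fact.out : ℓ.Prime)
  have hl1 : (1 : ℝ) < ℓ := by exact_mod_cast hl.one_lt
  by_cases hall : ∀ y ∈ fixedLayer σ ℓ m, (σ ^ j) y = y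
  · refine ⟨1, one_mem _, one_ne_zero, fun y hy => ?_⟩
    simp [hall y hy]
  push Not at hall
  obtain ⟨y₀, hy₀, hne⟩ := hall
  have val : ∀ y ∈ fixedLayer σ ℓ m, (σ ^ j) y ≠ y →
      IsLayerValue ℓ m (‖(σ ^ j) y - y‖ / ‖y‖) := fun y hy h =>
    (T.isLayerValue_norm (sub_mem (pow_apply_mem_fixedLayer hy j) hy) (sub_ne_zero.2 h)).div
      (T.isLayerValue_norm hy (by rintro rfl; simp at h)) hl.ne_zero
  -- The `ℓ ^ m`-th powers of the nonzero ratios are integral powers of `ℓ` and at most `1`, so a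
  -- largest exponent exists.
  obtain ⟨k, ⟨x, hx, hxne, hk⟩, hmax⟩ := Int.exists_greatest_of_bdd
    (P := fun k => ∃ y ∈ fixedLayer σ ℓ m, (σ ^ j) y ≠ y ∧
      (‖(σ ^ j) y - y‖ / ‖y‖) ^ (ℓ ^ m) = (ℓ : ℝ) ^ k)
    ⟨0, fun k ⟨y, hy, hyne, hk⟩ => by
      have h1 : ‖(σ ^ j) y - y‖ / ‖y‖ ≤ 1 :=
        div_le_one_of_le₀ (norm_sub_le_of_ultrametric (T.norm_pow j y).le le_rfl) (norm_nonneg _)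
      have h2 : (ℓ : ℝ) ^ k ≤ (ℓ : ℝ) ^ (0 : ℤ) := by
        rw [← hk, zpow_zero]; exact pow_le_one₀ (by positivity) h1
      exact (zpow_le_zpow_iff_right₀ hl1).1 h2⟩
    (by
      obtain ⟨k, hk⟩ := val y₀ hy₀ hne
      exact ⟨k, y₀, hy₀, hne, hk⟩)
  have hx0 : x ≠ 0 := by rintro rfl; simp at hxne
  refine ⟨x, hx, hx0, fun y hy => ?_⟩
  by_cases hyne : (σ ^ j) y = y
  · rw [hyne, sub_self, norm_zero, zero_mul]; positivity
  have hy0 : y ≠ 0 := by rintro rfl; simp at hyne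
  obtain ⟨k', hk'⟩ := val y hy hyne
  have h1 := hmax k' ⟨y, hy, hyne, hk'⟩
  have h2 : (‖(σ ^ j) y - y‖ / ‖y‖) ^ (ℓ ^ m) ≤ (‖(σ ^ j) x - x‖ / ‖x‖) ^ (ℓ ^ m) := by
    rw [hk, hk']; exact (zpow_le_zpow_iff_right₀ hl1).2 h1
  have h3 := (pow_le_pow_iff_left₀ (by positivity) (by positivity)
    (pow_ne_zero m hl.ne_zero)).1 h2
  rwa [div_le_div_iff₀ (norm_pos_iff.2 hy0) (norm_pos_iff.2 hx0)] at h3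

/-- A proper step without residue extension must enlarge the value group. Otherwise a maximally
moved `x`, divided by an element of layer `n` of the same norm and corrected by its residue, becomes
strictly smaller without losing displacement, against maximality. -/
theorem exists_not_isLayerValue (T : IsRamifiedTower ℓ e σ) (n : ℕ)
    (H : ∀ r > 0, IsLayerValue ℓ n r → ∃ x ∈ fixedLayer σ ℓ n, ‖x‖ = r) :
    ∃ x ∈ fixedLayer σ ℓ (n + 1), x ≠ 0 ∧ ¬ IsLayerValue ℓ n ‖x‖ := by
  by_contra! hc
  obtain ⟨x, hx, hx0, hmax⟩ := T.exists_maximal_contraction (n + 1) (ℓ ^ n)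
  have hxn : 0 < ‖x‖ := norm_pos_iff.2 hx0
  obtain ⟨b, hb, hbn⟩ := H ‖x‖ hxn (hc x hx hx0)
  have hb0 : b ≠ 0 := by rw [← norm_pos_iff, hbn]; exact hxn
  have hpos : 0 < ‖(σ ^ ℓ ^ n) x - x‖ := by
    obtain ⟨y, hy, hyn⟩ := T.strict n
    rw [mem_fixedLayer] at hyn
    have h1 : 0 < ‖(σ ^ ℓ ^ n) y - y‖ := norm_pos_iff.2 (sub_ne_zero.2 hyn)
    have h2 := hmax y hy
    have h3 : 0 < ‖(σ ^ ℓ ^ n) y - y‖ * ‖x‖ := by positivity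
    exact (pos_iff_pos_of_mul_pos (h3.trans_le h2)).2
      (norm_pos_iff.2 (by rintro rfl; simp at hyn))
  obtain ⟨a, ha, hua⟩ := T.exists_residue (x / b) (by rw [norm_div, hbn, div_self hxn.ne'])
  have hη : x / b - a ∈ fixedLayer σ ℓ (n + 1) :=
    sub_mem (div_mem hx (fixedLayer_mono n.le_succ hb)) (RingHom.pow_apply_eq_self ha _)
  have e : (σ ^ ℓ ^ n) x - x = b * ((σ ^ ℓ ^ n) (x / b - a) - (x / b - a)) := by
    rw [← RingHom.pow_apply_sub_eq ha, map_div₀, mem_fixedLayer.1 hb]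
    field_simp
  have h1 := hmax _ hη
  have h2 : ‖(σ ^ ℓ ^ n) x - x‖ ≤ ‖(σ ^ ℓ ^ n) x - x‖ * ‖x / b - a‖ := by
    calc _ = ‖(σ ^ ℓ ^ n) (x / b - a) - (x / b - a)‖ * ‖x‖ := by
          conv_lhs => rw [e]
          rw [norm_mul, hbn, mul_comm]
      _ ≤ _ := h1
  exact absurd h2 (not_le.2 (mul_lt_of_lt_one_right hpos hua))

theorem exists_norm_eq (T : IsRamifiedTower ℓ e σ) (n : ℕ) :
    ∀ r > 0, IsLayerValue ℓ n r → ∃ x ∈ fixedLayer σ ℓ n, ‖x‖ = r := by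
  induction n with
  | zero =>
    rintro r hr ⟨k, hk⟩
    obtain ⟨ϖ, hϖ, hϖn⟩ := T.exists_uniformizer
    refine ⟨ϖ ^ (-k), zpow_mem (mem_fixedLayer_zero.2 hϖ) _, ?_⟩
    rw [norm_zpow, hϖn, inv_zpow, zpow_neg, inv_inv, ← hk, pow_zero, pow_one]
  | succ n ih =>
    intro r hr h
    obtain ⟨x, hx, hx0, hxn⟩ := T.exists_not_isLayerValue n ih
    have hxp : 0 < ‖x‖ := norm_pos_iff.2 hx0
    obtain ⟨a, ha⟩ := h.exists_div_zpow hr hxp (T.isLayerValue_norm hx hx0) hxn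
    obtain ⟨b, hb, hbn⟩ := ih _ (by positivity) ha
    refine ⟨b * x ^ a, mul_mem (fixedLayer_mono n.le_succ hb) (zpow_mem hx a), ?_⟩
    rw [norm_mul, norm_zpow, hbn, div_mul_cancel₀ _ (by positivity)]

/-- The ratio is the largest one. By the prime index of value groups, a maximally moved `x` is a
unit times an element of layer `n` times a power of any `y` with a new value. Units and layer `n`
are moved by less than the ratio; were `y` too, so would be `x`. -/
theorem exists_step_contraction (T : IsRamifiedTower ℓ e σ) (n : ℕ) :
    ∃ ρ : ℝ, IsStepContraction ℓ σ n ρ := by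
  have hl := (Fact.out : ℓ.Prime)
  obtain ⟨x, hx, hx0, hmax⟩ := T.exists_maximal_contraction (n + 1) (ℓ ^ n)
  have hxn : 0 < ‖x‖ := norm_pos_iff.2 hx0
  have hpos : 0 < ‖(σ ^ ℓ ^ n) x - x‖ := by
    obtain ⟨y, hy, hyn⟩ := T.strict n
    rw [mem_fixedLayer] at hyn
    have h1 : 0 < ‖(σ ^ ℓ ^ n) y - y‖ := norm_pos_iff.2 (sub_ne_zero.2 hyn)
    have h2 := hmax y hy
    have h3 : 0 < ‖(σ ^ ℓ ^ n) y - y‖ * ‖x‖ := by positivity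
    exact (pos_iff_pos_of_mul_pos (h3.trans_le h2)).2
      (norm_pos_iff.2 (by rintro rfl; simp at hyn))
  set ρ := ‖(σ ^ ℓ ^ n) x - x‖ / ‖x‖ with hρ
  have hρ0 : 0 < ρ := by positivity
  have hle : ∀ y ∈ fixedLayer σ ℓ (n + 1), ‖(σ ^ (ℓ ^ n)) y - y‖ ≤ ρ * ‖y‖ := by
    intro y hy
    rw [hρ, div_mul_eq_mul_div, le_div_iff₀ hxn]
    exact hmax y hy
  refine ⟨ρ, hρ0, (div_lt_one hxn).2 (T.norm_pow_apply_sub_lt hx hx0 _),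
    (T.isLayerValue_norm (sub_mem (pow_apply_mem_fixedLayer hx _) hx) (norm_pos_iff.1 hpos)).div
      (T.isLayerValue_norm hx hx0) hl.ne_zero, hle, fun y hy hy0 hyn => ?_⟩
  refine (hle y hy).antisymm (not_lt.1 fun hlt => ?_)
  obtain ⟨H, hH⟩ := exists_subgroup_norm_sub_lt (T.norm_pow (ℓ ^ n)) hρ0
  have hyp : 0 < ‖y‖ := norm_pos_iff.2 hy0
  obtain ⟨k, hk⟩ := (T.isLayerValue_norm hx hx0).exists_div_zpow hxn hyp
    (T.isLayerValue_norm hy hy0) hyn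
  obtain ⟨b, hb, hbn⟩ := T.exists_norm_eq n _ (by positivity) hk
  have hb0 : b ≠ 0 := by rw [← norm_pos_iff, hbn]; positivity
  set u := x / (b * y ^ k) with hu
  have hu1 : ‖u‖ = 1 := by
    rw [hu, norm_div, norm_mul, norm_zpow, hbn, div_mul_cancel₀ _ (by positivity),
      div_self hxn.ne']
  have hu0 : u ≠ 0 := by rw [← norm_pos_iff, hu1]; exact one_pos
  have huM : u ∈ fixedLayer σ ℓ (n + 1) :=
    div_mem hx (mul_mem (fixedLayer_mono n.le_succ hb) (zpow_mem hy k))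
  obtain ⟨a, ha, hua⟩ := T.exists_residue u hu1.le
  have hyH : Units.mk0 y hy0 ∈ H := (hH _).2 hlt
  have hbH : Units.mk0 b hb0 ∈ H := by
    refine (hH _).2 ?_
    rw [Units.val_mk0, mem_fixedLayer.1 hb, sub_self, norm_zero]
    positivity
  have huH : Units.mk0 u hu0 ∈ H := by
    refine (hH _).2 ?_
    rw [Units.val_mk0, RingHom.pow_apply_sub_eq ha, hu1]
    exact (hle _ (sub_mem huM (RingHom.pow_apply_eq_self ha _))).trans_lt
      (mul_lt_mul_of_pos_left hua hρ0)
  have hxH := (hH _).1 (mul_mem huH (mul_mem hbH (zpow_mem hyH k)))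
  have e : ((Units.mk0 u hu0 * (Units.mk0 b hb0 * Units.mk0 y hy0 ^ k) : Fˣ) : F) = x := by
    simp only [Units.val_mul, Units.val_mk0, Units.val_zpow_eq_zpow_val]
    rw [hu, div_mul_cancel₀]
    exact mul_ne_zero hb0 (zpow_ne_zero _ hy0)
  rw [e, hρ, div_mul_cancel₀ _ hxn.ne'] at hxH
  exact lt_irrefl _ hxH

/-- While the distance to `m` is a value of layer `n`, the residue condition gives a better
approximation. Improvement must stop: distances are at least the displacement of `y`, and the values
are discrete. -/
theorem exists_best_approximation (T : IsRamifiedTower ℓ e σ) (n : ℕ) (y : F) :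
    ∃ m ∈ fixedLayer σ ℓ n, y = m ∨ ¬ IsLayerValue ℓ n ‖y - m‖ := by
  have hl := (Fact.out : ℓ.Prime)
  have hl1 : (1 : ℝ) < ℓ := by exact_mod_cast hl.one_lt
  by_contra! hc
  have hyn : (σ ^ ℓ ^ n) y ≠ y := fun h => (hc y h).1 rfl
  have hD : 0 < ‖(σ ^ ℓ ^ n) y - y‖ := norm_pos_iff.2 (sub_ne_zero.2 hyn)
  obtain ⟨b, hb⟩ := exists_mem_Ico_zpow (pow_pos hD (ℓ ^ n)) hl1
  obtain ⟨k, ⟨m, hm, hk⟩, hmin⟩ := Int.exists_least_of_bdd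
    (P := fun k => ∃ m ∈ fixedLayer σ ℓ n, ‖y - m‖ ^ (ℓ ^ n) = (ℓ : ℝ) ^ k)
    ⟨b, fun k ⟨m, hm, hk⟩ => by
      have h1 : ‖(σ ^ ℓ ^ n) y - y‖ ≤ ‖y - m‖ := by
        have : (σ ^ ℓ ^ n) y - y = (σ ^ ℓ ^ n) (y - m) - (y - m) := by
          rw [map_sub, mem_fixedLayer.1 hm]; ring
        rw [this]
        exact norm_sub_le_of_ultrametric (T.norm_pow _ _).le le_rfl
      refine (zpow_le_zpow_iff_right₀ hl1).1 ?_
      rw [← hk]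
      exact hb.1.trans (pow_le_pow_left₀ (norm_nonneg _) h1 _)⟩
    (by
      obtain ⟨k, hk⟩ := (hc 0 (zero_mem _)).2
      exact ⟨k, 0, zero_mem _, hk⟩)
  have hym : 0 < ‖y - m‖ := norm_pos_iff.2 (sub_ne_zero.2 (hc m hm).1)
  obtain ⟨c, hcM, hcn⟩ := T.exists_norm_eq n _ hym (hc m hm).2
  have hc0 : c ≠ 0 := by rw [← norm_pos_iff, hcn]; exact hym
  obtain ⟨a, ha, hua⟩ := T.exists_residue ((y - m) / c)
    (by rw [norm_div, hcn, div_self hym.ne'])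
  have hm' : m + a * c ∈ fixedLayer σ ℓ n :=
    add_mem hm (mul_mem (RingHom.pow_apply_eq_self ha _) hcM)
  have hlt : ‖y - (m + a * c)‖ < ‖y - m‖ := by
    have e : y - (m + a * c) = ((y - m) / c - a) * c := by field_simp; ring
    rw [e, norm_mul, hcn]
    exact mul_lt_of_lt_one_left hym hua
  obtain ⟨k', hk'⟩ := (hc _ hm').2
  have h1 := hmin k' ⟨_, hm', hk'⟩
  have h2 : ‖y - (m + a * c)‖ ^ (ℓ ^ n) < ‖y - m‖ ^ (ℓ ^ n) :=
    pow_lt_pow_left₀ hlt (norm_nonneg _) (pow_ne_zero n hl.ne_zero)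
  rw [hk, hk'] at h2
  exact absurd h1 (not_le.2 ((zpow_lt_zpow_iff_right₀ hl1).1 h2))

end IsRamifiedTower

end Tower

/-! ### Growth of ramification between consecutive steps. -/

section Gap

variable {F : Type*} [NormedField F]

/-- An explicit preimage under `t - 1`, applied to an element `θ` of trace `1`. -/
theorem exists_diff_eq_geom_sum_sub (t : F →+* F) (n : ℕ) (θ : F) :
    t (∑ i ∈ Finset.range n, ∑ k ∈ Finset.range i, (t ^ k) θ)
      - ∑ i ∈ Finset.range n, ∑ k ∈ Finset.range i, (t ^ k) θ
      = ∑ i ∈ Finset.range n, (t ^ i) θ - n * θ := by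
  rw [map_sum, ← Finset.sum_sub_distrib]
  have : ∀ i, t (∑ k ∈ Finset.range i, (t ^ k) θ) - ∑ k ∈ Finset.range i, (t ^ k) θ
      = (t ^ i) θ - θ := by
    intro i
    rw [← geom_sum_apply_diff, map_sum, ← Finset.sum_sub_distrib]
    refine Finset.sum_congr rfl fun k _ => ?_
    rw [map_sub]
    congr 1
    have := RingHom.pow_pow_comm_apply t 1 k θ
    rwa [pow_one] at this
  simp_rw [this]
  rw [Finset.sum_sub_distrib]
  simp

namespace IsRamifiedTower

variable {ℓ e : ℕ} {σ : F →+* F}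

theorem diffEnd_pow_mem {m : ℕ} {x : F} (hx : x ∈ fixedLayer σ ℓ m) (j k : ℕ) :
    (diffEnd (σ ^ j) ^ k) x ∈ fixedLayer σ ℓ m := by
  induction k with
  | zero => simpa using hx
  | succ k ih =>
    rw [pow_succ', Module.End.mul_apply]
    exact sub_mem (pow_apply_mem_fixedLayer ih j) ih

theorem norm_diffEnd_pow_le {m j : ℕ} {r : ℝ} (hr : 0 ≤ r)
    (h : ∀ x ∈ fixedLayer σ ℓ m, ‖(σ ^ j) x - x‖ ≤ r * ‖x‖) {x : F} (hx : x ∈ fixedLayer σ ℓ m)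
    (k : ℕ) : ‖(diffEnd (σ ^ j) ^ k) x‖ ≤ r ^ k * ‖x‖ := by
  induction k with
  | zero => simp
  | succ k ih =>
    rw [pow_succ', Module.End.mul_apply, pow_succ', mul_assoc]
    exact (h _ (diffEnd_pow_mem hx j k)).trans (mul_le_mul_of_nonneg_left ih hr)

/-- The contraction is exact only off the lower value group, so every intermediate norm has to avoid
it. -/
theorem norm_diffEnd_pow_eq {n : ℕ} {ρ : ℝ} (h : IsStepContraction ℓ σ n ρ) {x : F}
    (hx : x ∈ fixedLayer σ ℓ (n + 1)) (hx0 : x ≠ 0) (k : ℕ)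
    (hk : ∀ j < k, ¬ IsLayerValue ℓ n (ρ ^ j * ‖x‖)) :
    ‖(diffEnd (σ ^ ℓ ^ n) ^ k) x‖ = ρ ^ k * ‖x‖ := by
  induction k with
  | zero => simp
  | succ k ih =>
    have h1 := ih fun j hj => hk j (hj.trans k.lt_succ_self)
    rw [pow_succ', Module.End.mul_apply, pow_succ', mul_assoc, ← h1]
    refine h.norm_eq _ (diffEnd_pow_mem hx _ k) ?_ ?_
    · rw [← norm_pos_iff, h1]
      have := h.pos
      have := norm_pos_iff.2 hx0
      positivity
    · rw [h1]
      exact hk k k.lt_succ_self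

variable [IsUltrametricDist F]

theorem norm_pow_sub_le_of_step (T : IsRamifiedTower ℓ e σ) {n : ℕ} {ρ : ℝ}
    (h : IsStepContraction ℓ σ n ρ) {x : F} (hx : x ∈ fixedLayer σ ℓ (n + 1)) (i : ℕ) :
    ‖((σ ^ ℓ ^ n) ^ i) x - x‖ ≤ ρ * ‖x‖ := by
  have := h.pos
  rw [← geom_sum_apply_diff]
  refine norm_sum_le_of_ultrametric _ _ (by positivity) fun k _ => ?_
  rw [← pow_mul, T.norm_pow]
  exact h.norm_le x hx

variable [Fact ℓ.Prime]

/-- The trace is contracting. -/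
theorem norm_geom_sum_le (T : IsRamifiedTower ℓ e σ) {m j : ℕ} {r : ℝ} (hr : 0 ≤ r)
    (h : ∀ x ∈ fixedLayer σ ℓ m, ‖(σ ^ j) x - x‖ ≤ r * ‖x‖) {x : F} (hx : x ∈ fixedLayer σ ℓ m) :
    ‖∑ i ∈ Finset.range ℓ, ((σ ^ j) ^ i) x‖ ≤ max (r ^ (ℓ - 1)) ‖(ℓ : F)‖ * ‖x‖ := by
  obtain ⟨w, hw, hwx⟩ := exists_geom_sum_apply_eq ℓ (T.norm_pow j) x
  rw [hw]
  refine norm_add_le_of_ultrametric ((norm_diffEnd_pow_le hr h hx _).trans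
    (mul_le_mul_of_nonneg_right (le_max_left _ _) (norm_nonneg _))) ?_
  rw [norm_mul]
  exact mul_le_mul (le_max_right _ _) hwx (norm_nonneg _) (le_max_of_le_right (norm_nonneg _))

theorem norm_pow_sub_le (T : IsRamifiedTower ℓ e σ) {m j : ℕ} {r : ℝ} (hr : 0 ≤ r)
    (h : ∀ x ∈ fixedLayer σ ℓ m, ‖(σ ^ j) x - x‖ ≤ r * ‖x‖) {x : F} (hx : x ∈ fixedLayer σ ℓ m) :
    ‖((σ ^ j) ^ ℓ) x - x‖ ≤ max (r ^ (ℓ - 1)) ‖(ℓ : F)‖ * r * ‖x‖ := by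
  rw [← geom_sum_apply_diff, mul_assoc]
  exact (T.norm_geom_sum_le hr h (sub_mem (pow_apply_mem_fixedLayer hx j) hx)).trans
    (mul_le_mul_of_nonneg_left (h x hx) (le_max_of_le_right (norm_nonneg _)))

/-- The ramification break is prime to `ℓ` unless it is large. -/
theorem not_isLayerValue_of_lt (T : IsRamifiedTower ℓ e σ) {n : ℕ} {ρ : ℝ}
    (h : IsStepContraction ℓ σ n ρ) (hq : ‖(ℓ : F)‖ < ρ ^ (ℓ - 1)) : ¬ IsLayerValue ℓ n ρ := by
  have hl := (Fact.out : ℓ.Prime)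
  intro hρ
  obtain ⟨x, hx, hx0, hxn⟩ := T.exists_not_isLayerValue n (T.exists_norm_eq n)
  -- If `ρ` were an old value, all iterates of `s - 1` on `x` would keep new values and shrink by
  -- exactly `ρ`. But `s ^ ℓ` fixes `x`, which makes the `ℓ`-th iterate a multiple of `ℓ`.
  have key : ∀ j : ℕ, ¬ IsLayerValue ℓ n (ρ ^ j * ‖x‖) := fun j hj => hxn (by
    have := hj.div (hρ.zpow j) hl.ne_zero
    rwa [zpow_natCast, mul_div_cancel_left₀ _ (pow_ne_zero j h.pos.ne')] at this)
  obtain ⟨w, hw, hwx⟩ := exists_geom_sum_apply_eq ℓ (T.norm_pow (ℓ ^ n)) ((σ ^ ℓ ^ n) x - x)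
  rw [geom_sum_apply_diff, ← pow_mul, ← pow_succ, mem_fixedLayer.1 hx, sub_self,
    eq_comm, add_eq_zero_iff_eq_neg] at hw
  have h0 : ‖(σ ^ ℓ ^ n) x - x‖ = ρ * ‖x‖ := h.norm_eq x hx hx0 hxn
  have hpos : 0 < ρ * ‖x‖ := mul_pos h.pos (norm_pos_iff.2 hx0)
  have h1 : ‖(diffEnd (σ ^ ℓ ^ n) ^ (ℓ - 1)) ((σ ^ ℓ ^ n) x - x)‖ = ρ ^ (ℓ - 1) * (ρ * ‖x‖) := by
    rw [← h0]
    refine norm_diffEnd_pow_eq h (sub_mem (pow_apply_mem_fixedLayer hx _) hx)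
      (norm_pos_iff.1 (h0 ▸ hpos)) _ fun j _ => ?_
    rw [h0, ← mul_assoc, ← pow_succ]
    exact key _
  rw [hw, norm_neg, norm_mul] at h1
  rw [h0] at hwx
  have h2 : ‖(ℓ : F)‖ * ‖w‖ ≤ ‖(ℓ : F)‖ * (ρ * ‖x‖) := mul_le_mul_of_nonneg_left hwx (norm_nonneg _)
  rw [h1] at h2
  exact absurd (le_of_mul_le_mul_right h2 hpos) (not_le.2 hq)

/-- An element of trace `1` and small norm. -/
theorem exists_trace_eq_one (T : IsRamifiedTower ℓ e σ) {n : ℕ} {ρ : ℝ}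
    (h : IsStepContraction ℓ σ n ρ) (hq : ‖(ℓ : F)‖ < ρ ^ (ℓ - 1)) :
    ∃ θ ∈ fixedLayer σ ℓ (n + 1), ∑ i ∈ Finset.range ℓ, ((σ ^ ℓ ^ n) ^ i) θ = 1 ∧
      ‖θ‖ * ρ ^ (ℓ - 1) = 1 := by
  have hl := (Fact.out : ℓ.Prime)
  have hρ := T.not_isLayerValue_of_lt h hq
  have hpos := h.pos
  -- The norm is chosen so that `(s - 1) ^ (ℓ - 1)` takes `z` to a unit. The intermediate exponents
  -- of `ρ` lie strictly between `-ℓ` and `0`, hence are prime to `ℓ`.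
  obtain ⟨z, hz, hzn⟩ := T.exists_norm_eq (n + 1) (ρ ^ (-((ℓ - 1 : ℕ) : ℤ))) (by positivity)
    (h.isLayerValue.zpow _)
  have hz1 : ‖z‖ * ρ ^ (ℓ - 1) = 1 := by
    rw [hzn, zpow_neg, zpow_natCast, inv_mul_cancel₀ (by positivity)]
  have hz0 : z ≠ 0 := by rintro rfl; simp at hz1
  have h1 : ‖(diffEnd (σ ^ ℓ ^ n) ^ (ℓ - 1)) z‖ = 1 := by
    rw [norm_diffEnd_pow_eq h hz hz0, mul_comm, hz1]
    intro j hj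
    rw [hzn, ← zpow_natCast, ← zpow_add₀ hpos.ne']
    refine IsLayerValue.not_zpow hpos h.isLayerValue hρ fun hd => ?_
    have h2 : (ℓ : ℤ) ∣ ((ℓ - 1 - j : ℕ) : ℤ) := by
      rw [show ((ℓ - 1 - j : ℕ) : ℤ) = -((j : ℤ) + -((ℓ - 1 : ℕ) : ℤ)) by omega]
      exact hd.neg_right
    have := Nat.le_of_dvd (by omega) (Int.natCast_dvd_natCast.1 h2)
    omega
  obtain ⟨w, hw, hwz⟩ := exists_geom_sum_apply_eq ℓ (T.norm_pow (ℓ ^ n)) z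
  have h2 : ‖(ℓ : F) * w‖ < 1 := by
    rw [norm_mul, ← hz1, mul_comm ‖z‖]
    have : 0 < ‖z‖ := norm_pos_iff.2 hz0
    calc _ ≤ ‖(ℓ : F)‖ * ‖z‖ := mul_le_mul_of_nonneg_left hwz (norm_nonneg _)
      _ < _ := mul_lt_mul_of_pos_right hq this
  set S := ∑ i ∈ Finset.range ℓ, ((σ ^ ℓ ^ n) ^ i) z with hS
  have hS1 : ‖S‖ = 1 := by rw [hw, norm_add_eq_left_of_lt (by rwa [h1]), h1]
  have hSσ : (σ ^ ℓ ^ n) S = S :=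
    map_sum_range_pow (by rw [← pow_mul, ← pow_succ]; exact hz)
  have hS0 : S ≠ 0 := by rw [← norm_pos_iff, hS1]; exact one_pos
  refine ⟨z / S, div_mem hz (fixedLayer_mono n.le_succ hSσ), ?_, by rw [norm_div, hS1, div_one, hz1]⟩
  simp_rw [map_div₀, RingHom.pow_apply_eq_self hSσ]
  rw [← Finset.sum_div, ← hS, div_self hS0]

/-- Norms of principal units: compatibility of the ramification of a step of the tower with the
one of the next layer. -/
theorem pow_contraction_le (T : IsRamifiedTower ℓ e σ) {n : ℕ} {ρ ρ' : ℝ}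
    (h : IsStepContraction ℓ σ n ρ) (h' : IsStepContraction ℓ σ (n + 1) ρ') {x : F}
    (hx : x ∈ fixedLayer σ ℓ (n + 2)) (hx0 : x ≠ 0) {r : ℝ} (hr : ‖(σ ^ ℓ ^ n) x - x‖ = r * ‖x‖)
    (hr0 : 0 < r) (hr1 : r < 1) (hq : ‖(ℓ : F)‖ < r ^ (ℓ - 1)) (hρr : ρ' ≤ r ^ ℓ) : r ^ ℓ ≤ ρ := by
  have hpos := h.pos
  have hpos' := h'.pos
  have hxn : 0 < ‖x‖ := norm_pos_iff.2 hx0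
  set s := σ ^ ℓ ^ n with hs
  set t := σ ^ ℓ ^ (n + 1) with ht
  set u := s x / x with hu
  have hu1 : ‖u‖ = 1 := by rw [hu, norm_div, T.norm_pow, div_self hxn.ne']
  have hβ : ‖u - 1‖ = r := by
    have e : u - 1 = (s x - x) / x := by rw [hu]; field_simp
    rw [e, norm_div, hr, mul_div_cancel_right₀ _ hxn.ne']
  have huM : u ∈ fixedLayer σ ℓ (n + 2) := div_mem (pow_apply_mem_fixedLayer hx _) hx
  set x₁ := ∏ i ∈ Finset.range ℓ, (t ^ i) x with hx₁
  have hx₁M : x₁ ∈ fixedLayer σ ℓ (n + 1) :=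
    map_prod_range_pow (by rw [← pow_mul, ← pow_succ]; exact hx)
  have hx₁0 : x₁ ≠ 0 := Finset.prod_ne_zero_iff.2 fun i _ => (map_ne_zero _).2 hx0
  have hprod : s x₁ / x₁ = ∏ i ∈ Finset.range ℓ, (t ^ i) u := by
    rw [hx₁, map_prod, ← Finset.prod_div_distrib]
    refine Finset.prod_congr rfl fun i _ => ?_
    rw [hu, map_div₀, ht, hs, ← pow_mul, RingHom.pow_pow_comm_apply]
  -- The norm of the principal unit `u` is close to `u ^ ℓ`, whose distance to `1` is `r ^ ℓ`; the
  -- error is smaller than that because `ρ' ≤ r ^ ℓ`.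
  have h1 : ‖∏ i ∈ Finset.range ℓ, (t ^ i) u - u ^ ℓ‖ ≤ ρ' * r := by
    have e : u ^ ℓ = ∏ i ∈ Finset.range ℓ, u := by simp
    rw [e]
    refine norm_prod_sub_prod_le _ _ _ (by positivity) (fun i _ => ?_) (fun i _ => hu1.le)
      fun i _ => ?_
    · rw [ht, ← pow_mul, T.norm_pow, hu1]
    · have e : (t ^ i) u - u = (t ^ i) (u - 1) - (u - 1) := by rw [map_sub, map_one]; ring
      rw [e, ← hβ]
      exact T.norm_pow_sub_le_of_step h' (sub_mem huM (one_mem _)) i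
  have h2 : ‖u ^ ℓ - 1‖ = r ^ ℓ := by
    have := norm_one_add_pow_sub_one ℓ (β := u - 1) (hβ.trans_lt hr1).le (by rwa [hβ])
    rwa [add_sub_cancel, hβ] at this
  have h3 : ‖s x₁ / x₁ - 1‖ = r ^ ℓ := by
    have e : s x₁ / x₁ - 1 = (u ^ ℓ - 1) + (∏ i ∈ Finset.range ℓ, (t ^ i) u - u ^ ℓ) := by
      rw [hprod]; ring
    rw [e, norm_add_eq_left_of_lt, h2]
    rw [h2]
    calc _ ≤ ρ' * r := h1
      _ ≤ r ^ ℓ * r := mul_le_mul_of_nonneg_right hρr hr0.le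
      _ < r ^ ℓ := mul_lt_of_lt_one_right (by positivity) hr1
  have h4 := h.norm_le x₁ hx₁M
  have e : s x₁ - x₁ = (s x₁ / x₁ - 1) * x₁ := by field_simp
  rw [e, norm_mul, h3] at h4
  exact le_of_mul_le_mul_right h4 (norm_pos_iff.2 hx₁0)

/-- The growth of the ramification along the tower. -/
theorem contraction_pow_le (T : IsRamifiedTower ℓ e σ) {n : ℕ} {ρ ρ' : ℝ}
    (h : IsStepContraction ℓ σ n ρ) (h' : IsStepContraction ℓ σ (n + 1) ρ')
    (hq : ‖(ℓ : F)‖ < ρ' ^ (ℓ - 1)) : ρ' ^ ℓ ≤ ρ * max (ρ ^ (ℓ * (ℓ - 1))) ‖(ℓ : F)‖ := by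
  have hl := (Fact.out : ℓ.Prime)
  have hl1 : ℓ - 1 ≠ 0 := by have := hl.two_le; omega
  have hℓ : ℓ - 1 + 1 = ℓ := Nat.sub_add_cancel hl.one_le
  have hq0 := T.norm_natCast_pos
  have hq1 := T.norm_natCast_lt_one
  have hpos := h.pos
  have hpos' := h'.pos
  set q := ‖(ℓ : F)‖ with hqdef
  have hst : σ ^ ℓ ^ (n + 1) = (σ ^ ℓ ^ n) ^ ℓ := by rw [← pow_mul, ← pow_succ]
  obtain ⟨x, hx, hx0, hmax⟩ := T.exists_maximal_contraction (n + 2) (ℓ ^ n)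
  have hxn : 0 < ‖x‖ := norm_pos_iff.2 hx0
  set r := ‖(σ ^ ℓ ^ n) x - x‖ / ‖x‖ with hr
  have hrx : ‖(σ ^ ℓ ^ n) x - x‖ = r * ‖x‖ := by rw [hr, div_mul_cancel₀ _ hxn.ne']
  have hr0 : 0 ≤ r := by positivity
  have hr1 : r < 1 := (div_lt_one hxn).2 (T.norm_pow_apply_sub_lt hx hx0 _)
  have hrle : ∀ y ∈ fixedLayer σ ℓ (n + 2), ‖(σ ^ ℓ ^ n) y - y‖ ≤ r * ‖y‖ := by
    intro y hy
    rw [hr, div_mul_eq_mul_div, le_div_iff₀ hxn]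
    exact hmax y hy
  have hρ'q : ¬ ρ' ≤ q := fun hc =>
    absurd hq (not_lt.2 ((pow_le_of_le_one hpos'.le h'.lt_one.le hl1).trans hc))
  -- Test `t - 1 = (1 + s + ⋯ + s ^ (ℓ - 1)) (s - 1)` on an element which `t - 1` contracts by
  -- exactly `ρ'`.
  have hρ'r : ρ' ≤ max (r ^ (ℓ - 1)) q * r := by
    obtain ⟨y, hy, hy0, hyn⟩ := T.exists_not_isLayerValue (n + 1) (T.exists_norm_eq (n + 1))
    have h1 := h'.norm_eq y hy hy0 hyn
    have h2 := T.norm_pow_sub_le hr0 hrle hy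
    rw [← hst, h1] at h2
    exact le_of_mul_le_mul_right h2 (norm_pos_iff.2 hy0)
  have hqr : q < r ^ (ℓ - 1) := by
    by_contra! hc
    rw [max_eq_right hc] at hρ'r
    exact hρ'q (hρ'r.trans (mul_le_of_le_one_right hq0.le hr1.le))
  rw [max_eq_left hqr.le, ← pow_succ, hℓ] at hρ'r
  have hrpos : 0 < r := by
    refine hr0.lt_of_ne fun hc => ?_
    rw [← hc, zero_pow hl1] at hqr
    exact absurd hqr (not_lt.2 hq0.le)
  have hrρ : r ^ ℓ ≤ ρ := T.pow_contraction_le h h' hx hx0 hrx hrpos hr1 hqr hρ'r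
  obtain ⟨θ, hθM, hθ, hθn⟩ := T.exists_trace_eq_one h' hq
  have hθq : ‖(ℓ : F) * θ‖ < 1 := by
    have : 0 < ‖θ‖ := norm_pos_iff.2 (by rintro rfl; simp at hθn)
    rw [norm_mul, ← hθn, mul_comm ‖θ‖]
    exact mul_lt_mul_of_pos_right hq this
  have h1θ : ‖1 - (ℓ : F) * θ‖ = 1 := by
    rw [sub_eq_add_neg, norm_add_eq_left_of_lt (by rwa [norm_neg, norm_one]), norm_one]
  set s := σ ^ ℓ ^ n with hs
  set t := σ ^ ℓ ^ (n + 1) with ht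
  obtain ⟨y, hyM, hy⟩ : ∃ y ∈ fixedLayer σ ℓ (n + 2), t y - y = 1 - ℓ * θ := by
    refine ⟨_, ?_, by rw [← hθ]; exact exists_diff_eq_geom_sum_sub t ℓ θ⟩
    refine sum_mem fun i _ => sum_mem fun k _ => ?_
    rw [ht, ← pow_mul]
    exact pow_apply_mem_fixedLayer hθM _
  -- Subtracting an element fixed by `t` keeps `(t - 1) y` and makes the contraction exact, so that
  -- `‖y₁‖ = ρ'⁻¹`.
  obtain ⟨m, hm, hym⟩ := T.exists_best_approximation (n + 1) y
  have htm : t m = m := hm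
  set y₁ := y - m with hy₁
  have hy₁M : y₁ ∈ fixedLayer σ ℓ (n + 2) := sub_mem hyM (fixedLayer_mono (Nat.le_succ _) hm)
  have hty₁ : t y₁ - y₁ = 1 - ℓ * θ := by rw [← hy, hy₁, map_sub, htm]; ring
  have hy₁0 : y₁ ≠ 0 := by
    intro hc
    rw [hc, map_zero, sub_zero] at hty₁
    rw [← hty₁, norm_zero] at h1θ
    exact zero_ne_one h1θ
  have hy₁n : ρ' * ‖y₁‖ = 1 := by
    rw [← h1θ, ← hty₁]
    exact (h'.norm_eq y₁ hy₁M hy₁0 (hym.resolve_left (sub_ne_zero.1 hy₁0))).symm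
  set z := s y₁ - y₁ with hz
  have hzM : z ∈ fixedLayer σ ℓ (n + 2) := sub_mem (pow_apply_mem_fixedLayer hy₁M _) hy₁M
  have hzn : ρ' * ‖z‖ ≤ r := by
    calc ρ' * ‖z‖ ≤ ρ' * (r * ‖y₁‖) := mul_le_mul_of_nonneg_left (hrle _ hy₁M) hpos'.le
      _ = r * (ρ' * ‖y₁‖) := by ring
      _ = r := by rw [hy₁n, mul_one]
  obtain ⟨z₀, hz₀M, hz₀⟩ := T.exists_best_approximation (n + 1) z
  have htz₀ : t z₀ = z₀ := hz₀M
  set z' := z - z₀ with hz'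
  have hz'M : z' ∈ fixedLayer σ ℓ (n + 2) := sub_mem hzM (fixedLayer_mono (Nat.le_succ _) hz₀M)
  -- Since `s` and `t` commute and `(t - 1) y₁ = 1 - ℓ θ`, the constant `1` is killed by `s - 1`.
  -- The remaining factor `ℓ` makes `z'` small.
  have htz' : t z' - z' = -(ℓ * (s θ - θ)) := by
    have e1 : t (s y₁) = s (t y₁) := RingHom.pow_pow_comm_apply σ _ _ y₁
    have e2 : t y₁ = y₁ + (1 - ℓ * θ) := by rw [← hty₁]; ring
    have e3 : s (t y₁) = s y₁ + (1 - ℓ * s θ) := by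
      rw [e2, map_add, map_sub s 1, map_mul, map_one, map_natCast]
    rw [hz', map_sub, htz₀, hz, map_sub, e1, e3, e2]
    ring
  have hz'n : ρ' ^ ℓ * ‖z'‖ ≤ q * r := by
    rcases eq_or_ne z' 0 with h0 | h0
    · rw [h0, norm_zero, mul_zero]; positivity
    · have h1 := h'.norm_eq z' hz'M h0 (hz₀.resolve_left (sub_ne_zero.1 h0))
      rw [htz', norm_neg, norm_mul] at h1
      calc ρ' ^ ℓ * ‖z'‖ = ρ' ^ (ℓ - 1) * (ρ' * ‖z'‖) := by rw [← mul_assoc, ← pow_succ, hℓ]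
        _ = ρ' ^ (ℓ - 1) * (q * ‖s θ - θ‖) := by rw [← h1]
        _ ≤ ρ' ^ (ℓ - 1) * (q * (r * ‖θ‖)) := by gcongr; exact hrle _ hθM
        _ = q * r * (‖θ‖ * ρ' ^ (ℓ - 1)) := by ring
        _ = q * r := by rw [hθn, mul_one]
  have hzz' : z = z₀ + z' := by rw [hz']; ring
  -- No cancellation can occur: a nonzero `z₀` has a value of layer `n + 1`, a nonzero `z'` does
  -- not.
  have hz₀z : ‖z₀‖ ≤ ‖z‖ := by
    rcases eq_or_ne z' 0 with h0 | h0
    · rw [hzz', h0, add_zero]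
    rcases eq_or_ne z₀ 0 with h1 | h1
    · rw [h1, norm_zero]; positivity
    rw [hzz', IsUltrametricDist.norm_add_eq_max_of_norm_ne_norm]
    · exact le_max_left _ _
    · intro hc
      exact hz₀.resolve_left (sub_ne_zero.1 h0) (hc ▸ T.isLayerValue_norm hz₀M h1)
  -- The sum telescopes to `(t - 1) y₁`, a unit. The two summands are then bounded with the ratio
  -- `ρ` of layer `n + 1` for `z₀` and the ratio `r` of layer `n + 2` for `z'`.
  have hN : ‖∑ i ∈ Finset.range ℓ, (s ^ i) z₀ + ∑ i ∈ Finset.range ℓ, (s ^ i) z'‖ = 1 := by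
    rw [← h1θ, ← hty₁, hst, ← geom_sum_apply_diff, ← hz, hzz', ← Finset.sum_add_distrib]
    simp_rw [map_add]
  have hN0 := T.norm_geom_sum_le hpos.le h.norm_le hz₀M
  have hN' := T.norm_geom_sum_le hr0 hrle hz'M
  rw [max_eq_left hqr.le] at hN'
  have h1 := IsUltrametricDist.norm_add_le_max (∑ i ∈ Finset.range ℓ, (s ^ i) z₀)
    (∑ i ∈ Finset.range ℓ, (s ^ i) z')
  rw [hN] at h1
  rcases le_max_iff.1 h1 with h2 | h2
  · have h3 : ρ' ≤ max (ρ ^ (ℓ - 1)) q * r := by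
      calc ρ' = ρ' * 1 := (mul_one _).symm
        _ ≤ ρ' * (max (ρ ^ (ℓ - 1)) q * ‖z‖) := by
          refine mul_le_mul_of_nonneg_left (h2.trans (hN0.trans ?_)) hpos'.le
          exact mul_le_mul_of_nonneg_left hz₀z (le_max_of_le_right hq0.le)
        _ = max (ρ ^ (ℓ - 1)) q * (ρ' * ‖z‖) := by ring
        _ ≤ _ := mul_le_mul_of_nonneg_left hzn (le_max_of_le_right hq0.le)
    calc ρ' ^ ℓ ≤ (max (ρ ^ (ℓ - 1)) q * r) ^ ℓ := pow_le_pow_left₀ hpos'.le h3 _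
      _ = r ^ ℓ * (max (ρ ^ (ℓ - 1)) q) ^ ℓ := by rw [mul_pow, mul_comm]
      _ ≤ ρ * max (ρ ^ (ℓ * (ℓ - 1))) q := by
        refine mul_le_mul hrρ ?_ (by positivity) hpos.le
        rcases max_cases (ρ ^ (ℓ - 1)) q with ⟨h4, _⟩ | ⟨h4, _⟩
        · rw [h4, ← pow_mul, mul_comm]; exact le_max_left _ _
        · rw [h4]; exact (pow_le_of_le_one hq0.le hq1.le hl.ne_zero).trans (le_max_right _ _)
  · calc ρ' ^ ℓ = ρ' ^ ℓ * 1 := (mul_one _).symm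
      _ ≤ ρ' ^ ℓ * (r ^ (ℓ - 1) * ‖z'‖) :=
        mul_le_mul_of_nonneg_left (h2.trans hN') (by positivity)
      _ = r ^ (ℓ - 1) * (ρ' ^ ℓ * ‖z'‖) := by ring
      _ ≤ r ^ (ℓ - 1) * (q * r) := mul_le_mul_of_nonneg_left hz'n (by positivity)
      _ = r ^ (ℓ - 1 + 1) * q := by rw [pow_succ]; ring
      _ = r ^ ℓ * q := by rw [hℓ]
      _ ≤ ρ * q := mul_le_mul_of_nonneg_right hrρ hq0.le
      _ ≤ _ := mul_le_mul_of_nonneg_left (le_max_right _ _) hpos.le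

end IsRamifiedTower

end Gap

/-! ### Summation of the ramification deficits. -/

/-- The total loss along a tower whose ramification exponents `α n` grow as in a `ℤ_p`-extension. -/
theorem sum_ramification_deficit_le {p e : ℝ} (hp : 2 ≤ p) (he : 1 ≤ e) (α : ℕ → ℝ)
    (h0 : 1 ≤ p * α 0)
    (hα : ∀ n, e ≤ (p - 1) * α (n + 1) ∨ α n + min (p * (p - 1) * α n) e ≤ p * α (n + 1)) (n : ℕ) :
    ∑ i ∈ Finset.range n, max 0 (e - (p - 1) * α (i + 1)) ≤ 2 * p / (p - 1) ^ 2 * e ^ 2 := by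
  obtain ⟨c, rfl⟩ : ∃ c, p = c + 1 := ⟨p - 1, by ring⟩
  simp only [add_sub_cancel_right] at *
  have hc : 1 ≤ c := by linarith
  have hge : ∀ n, 1 ≤ (c + 1) * α n := by
    intro n
    induction n with
    | zero => exact h0
    | succ n ih =>
      have hα0 : 0 < α n := by
        by_contra! hneg
        nlinarith
      rcases hα n with h | h
      · have : 0 < α (n + 1) := by
          by_contra! hneg
          nlinarith
        nlinarith
      · rcases min_cases ((c + 1) * c * α n) e with ⟨h1, _⟩ | ⟨h1, _⟩ <;> rw [h1] at h <;> nlinarith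
  have hpos : ∀ n, 0 < α n := fun n => by
    by_contra! hneg
    nlinarith [hge n]
  set δ : ℕ → ℝ := fun n => max 0 (e - c * α n) with hδ
  set D : ℕ → ℝ := fun n => max 0 (e - (c + 1) * c * α n) with hD
  have hδ0 : ∀ n, 0 ≤ δ n := fun n => le_max_left _ _
  have hD0 : ∀ n, 0 ≤ D n := fun n => le_max_left _ _
  have step1 : ∀ n, (c + 1) * δ (n + 1) ≤ δ n + c * D n := by
    intro n
    have h1 : e - c * α n ≤ δ n := le_max_right _ _
    have h2 : e - (c + 1) * c * α n ≤ D n := le_max_right _ _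
    have h3 := hδ0 n
    have h4 := hD0 n
    have h5 : 0 ≤ c * D n := by positivity
    rcases max_cases 0 (e - c * α (n + 1)) with ⟨h6, _⟩ | ⟨h6, h7⟩
    · rw [hδ]; simp only [h6]; linarith
    · have h8 := (hα n).resolve_left (by linarith)
      have : δ (n + 1) = e - c * α (n + 1) := h6
      rw [this]
      have h9 : c * (α n + min ((c + 1) * c * α n) e) ≤ c * ((c + 1) * α (n + 1)) :=
        mul_le_mul_of_nonneg_left h8 (by linarith)
      rcases min_cases ((c + 1) * c * α n) e with ⟨h10, _⟩ | ⟨h10, _⟩ <;> rw [h10] at h9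
      · have : c * (e - (c + 1) * c * α n) ≤ c * D n := mul_le_mul_of_nonneg_left h2 (by linarith)
        linarith
      · linarith
  -- In the regime of the first minimum the gain is `c ^ 3 * α n ≥ c ^ 3 / (c + 1) ≥ c / 2`, by
  -- `hge` and `1 ≤ c`.
  have step2 : ∀ n, D (n + 1) ≤ max 0 (D n - c / 2) := by
    intro n
    have h2 : e - (c + 1) * c * α n ≤ D n := le_max_right _ _
    have hp1 := hpos n
    have hp2 := hpos (n + 1)
    have hzero : e ≤ (c + 1) * c * α (n + 1) → D (n + 1) ≤ max 0 (D n - c / 2) := fun h => by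
      have : D (n + 1) = 0 := max_eq_left (by linarith)
      rw [this]
      exact le_max_left _ _
    rcases hα n with h | h
    · have := mul_pos (mul_pos (zero_lt_one.trans_le hc) (zero_lt_one.trans_le hc)) hp2
      exact hzero (by nlinarith)
    · have h9 : c * (α n + min ((c + 1) * c * α n) e) ≤ c * ((c + 1) * α (n + 1)) :=
        mul_le_mul_of_nonneg_left h (by linarith)
      rcases min_cases ((c + 1) * c * α n) e with ⟨h10, _⟩ | ⟨h10, _⟩ <;> rw [h10] at h9
      · refine max_le (le_max_left _ _) ((?_ : _ ≤ D n - c / 2).trans (le_max_right _ _))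
        have hcc : 0 ≤ c * (c - 1) := mul_nonneg (by linarith) (by linarith)
        have h11 := mul_le_mul_of_nonneg_left (hge n) (by positivity : 0 ≤ c)
        have h12 : c / 2 ≤ c * α n + c * ((c + 1) * c * α n) - (c + 1) * c * α n := by
          have := hge n
          nlinarith [mul_nonneg hcc (sub_nonneg.2 (hge n)), mul_nonneg hcc hp1.le]
        linarith
      · exact hzero (by nlinarith [mul_pos (zero_lt_one.trans_le hc) hp1])
  have step3 : ∀ n, D (n + 1) ^ 2 / c + D (n + 1) ≤ D n ^ 2 / c := by
    intro n
    have h1 := step2 n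
    have h2 := hD0 (n + 1)
    have h3 := hD0 n
    rw [← sub_nonneg]
    have e1 : D n ^ 2 / c - (D (n + 1) ^ 2 / c + D (n + 1))
        = (D n ^ 2 - D (n + 1) ^ 2 - c * D (n + 1)) / c := by field_simp; ring
    rw [e1]
    refine div_nonneg ?_ (by linarith)
    rcases max_cases 0 (D n - c / 2) with ⟨h4, _⟩ | ⟨h4, h5⟩ <;> rw [h4] at h1
    · have : D (n + 1) = 0 := le_antisymm h1 h2
      rw [this]; nlinarith
    · nlinarith
  -- The left side is a nonincreasing potential: `δ n / c` absorbs the recursion `step1`, and `D n ^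
  -- 2 / c` pays for the linearly decreasing `D`.
  have key : ∀ n, ∑ i ∈ Finset.range n, δ (i + 1) + δ n / c + (D n ^ 2 / c + D n) ≤
      δ 0 / c + (D 0 ^ 2 / c + D 0) := by
    intro n
    induction n with
    | zero => simp
    | succ n ih =>
      rw [Finset.sum_range_succ]
      have h1 : δ (n + 1) + δ (n + 1) / c ≤ δ n / c + D n := by
        have := div_le_div_of_nonneg_right (step1 n) (by linarith : 0 ≤ c)
        have e1 : (c + 1) * δ (n + 1) / c = δ (n + 1) + δ (n + 1) / c := by field_simp
        have e2 : (δ n + c * D n) / c = δ n / c + D n := by field_simp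
        rwa [e1, e2] at this
      linarith [step3 n]
  have hlast : δ 0 / c + (D 0 ^ 2 / c + D 0) ≤ 2 * (c + 1) / c ^ 2 * e ^ 2 := by
    have h1 : δ 0 ≤ e := max_le (by linarith) (by nlinarith [hpos 0])
    have h2 : D 0 ≤ max 0 (e - c) := max_le_max le_rfl (by nlinarith [hge 0])
    have h3 : D 0 ^ 2 + c * D 0 ≤ e ^ 2 := by
      have h4 := hD0 0
      rcases max_cases 0 (e - c) with ⟨h5, _⟩ | ⟨h5, h6⟩ <;> rw [h5] at h2
      · have : D 0 = 0 := le_antisymm h2 h4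
        rw [this]; nlinarith
      · nlinarith
    have e1 : δ 0 / c + (D 0 ^ 2 / c + D 0) = c * (δ 0 + (D 0 ^ 2 + c * D 0)) / c ^ 2 := by
      field_simp
    rw [e1, div_mul_eq_mul_div]
    refine div_le_div_of_nonneg_right ?_ (by positivity)
    have h4 : δ 0 + (D 0 ^ 2 + c * D 0) ≤ 2 * e ^ 2 := by nlinarith
    calc _ ≤ c * (2 * e ^ 2) := mul_le_mul_of_nonneg_left h4 (by linarith)
      _ ≤ _ := by nlinarith [sq_nonneg e]
  have h1 := key n
  have h2 : 0 ≤ δ n / c := div_nonneg (hδ0 n) (by linarith)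
  have h3 : 0 ≤ D n ^ 2 / c := by positivity
  linarith [hD0 n]

/-! ### The inequality for the normalized trace in a tower. -/

theorem RingHom.sum_range_pow_mul {F : Type*} [Field F] (s : F →+* F) (m k : ℕ) (x : F) :
    ∑ i ∈ Finset.range (m * k), (s ^ i) x
      = ∑ i ∈ Finset.range m, (s ^ i) (∑ j ∈ Finset.range k, ((s ^ m) ^ j) x) := by
  simp_rw [map_sum]
  rw [Finset.sum_comm]
  induction k with
  | zero => simp
  | succ k ih =>
    rw [mul_add_one, Finset.sum_range_add, ih, Finset.sum_range_succ]
    congr 1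
    refine Finset.sum_congr rfl fun i _ => ?_
    rw [← pow_mul, RingHom.pow_pow_comm_apply, pow_add]
    rfl

namespace IsRamifiedTower

variable {F : Type*} [NormedField F] [IsUltrametricDist F]
variable {ℓ e : ℕ} {σ : F →+* F}

theorem norm_pow_sub_le_norm_sub (T : IsRamifiedTower ℓ e σ) (k : ℕ) (x : F) :
    ‖(σ ^ k) x - x‖ ≤ ‖σ x - x‖ := by
  rw [← geom_sum_apply_diff]
  exact norm_sum_le_of_ultrametric _ _ (norm_nonneg _) fun i _ => (T.norm_pow _ _).le

variable [Fact ℓ.Prime]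

theorem norm_sub_trace_step (T : IsRamifiedTower ℓ e σ) (n : ℕ) (x : F) :
    ‖x - (ℓ : F)⁻¹ * ∑ i ∈ Finset.range ℓ, ((σ ^ ℓ ^ n) ^ i) x‖ ≤ ‖(ℓ : F)‖⁻¹ * ‖x - σ x‖ := by
  have hq := T.norm_natCast_pos
  have hl0 : (ℓ : F) ≠ 0 := norm_pos_iff.1 hq
  have e1 : x - (ℓ : F)⁻¹ * ∑ i ∈ Finset.range ℓ, ((σ ^ ℓ ^ n) ^ i) x
      = -((ℓ : F)⁻¹ * ∑ i ∈ Finset.range ℓ, (((σ ^ ℓ ^ n) ^ i) x - x)) := by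
    rw [Finset.sum_sub_distrib]
    simp only [Finset.sum_const, Finset.card_range, nsmul_eq_mul]
    field_simp
    ring
  rw [e1, norm_neg, norm_mul, norm_inv, norm_sub_rev x]
  refine mul_le_mul_of_nonneg_left ?_ (by positivity)
  refine norm_sum_le_of_ultrametric _ _ (norm_nonneg _) fun i _ => ?_
  rw [← pow_mul]
  exact T.norm_pow_sub_le_norm_sub _ x

theorem norm_trace_step_sub (T : IsRamifiedTower ℓ e σ) {n : ℕ} {ρ : ℝ}
    (h : IsStepContraction ℓ σ n ρ) {x : F} (hx : x ∈ fixedLayer σ ℓ (n + 1)) :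
    ‖(ℓ : F)⁻¹ * ∑ i ∈ Finset.range ℓ, ((σ ^ ℓ ^ n) ^ i) x
      - σ ((ℓ : F)⁻¹ * ∑ i ∈ Finset.range ℓ, ((σ ^ ℓ ^ n) ^ i) x)‖ ≤
      ‖(ℓ : F)‖⁻¹ * max (ρ ^ (ℓ - 1)) ‖(ℓ : F)‖ * ‖x - σ x‖ := by
  have hσx : σ x ∈ fixedLayer σ ℓ (n + 1) := by
    have := pow_apply_mem_fixedLayer hx 1
    rwa [pow_one] at this
  have e1 : (ℓ : F)⁻¹ * ∑ i ∈ Finset.range ℓ, ((σ ^ ℓ ^ n) ^ i) x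
      - σ ((ℓ : F)⁻¹ * ∑ i ∈ Finset.range ℓ, ((σ ^ ℓ ^ n) ^ i) x)
      = (ℓ : F)⁻¹ * ∑ i ∈ Finset.range ℓ, ((σ ^ ℓ ^ n) ^ i) (x - σ x) := by
    rw [map_mul, map_inv₀, map_natCast, ← mul_sub, map_sum, ← Finset.sum_sub_distrib]
    congr 1
    refine Finset.sum_congr rfl fun i _ => ?_
    rw [map_sub, ← pow_mul]
    congr 1
    have := RingHom.pow_pow_comm_apply σ 1 (ℓ ^ n * i) x
    rwa [pow_one] at this
  rw [e1, norm_mul, norm_inv, mul_assoc]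
  exact mul_le_mul_of_nonneg_left (T.norm_geom_sum_le h.pos.le h.norm_le (sub_mem hx hσx))
    (by positivity)

theorem norm_sub_normalizedTrace_le (T : IsRamifiedTower ℓ e σ) (n : ℕ) {x : F}
    (hx : x ∈ fixedLayer σ ℓ n) :
    ‖x - ((ℓ : F) ^ n)⁻¹ * ∑ i ∈ Finset.range (ℓ ^ n), (σ ^ i) x‖ ≤
      (ℓ : ℝ) ^ (e + 2 * (ℓ : ℝ) / ((ℓ : ℝ) - 1) ^ 2 * (e : ℝ) ^ 2) * ‖x - σ x‖ := by
  have hl := (Fact.out : ℓ.Prime)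
  have hl1 : (1 : ℝ) < ℓ := by exact_mod_cast hl.one_lt
  have hl0 : (0 : ℝ) < ℓ := by linarith
  have hcast : ((ℓ - 1 : ℕ) : ℝ) = (ℓ : ℝ) - 1 := by rw [Nat.cast_sub hl.one_le, Nat.cast_one]
  choose ρ hρ using T.exists_step_contraction
  set α : ℕ → ℝ := fun n => -Real.logb ℓ (ρ n) with hα
  have hρα : ∀ n k : ℕ, ρ n ^ k = (ℓ : ℝ) ^ (-(k * α n)) := by
    intro n k
    have : ρ n = (ℓ : ℝ) ^ (-α n) := by
      rw [hα, neg_neg, Real.rpow_logb hl0 hl1.ne' (hρ n).pos]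
    conv_lhs => rw [this]
    rw [← Real.rpow_natCast, ← Real.rpow_mul hl0.le]
    congr 1
    ring
  have hq : ‖(ℓ : F)‖ = (ℓ : ℝ) ^ (-(e : ℝ)) := by
    rw [T.norm_natCast, ← Real.rpow_intCast]
    push_cast
    rfl
  -- `ρ 0 ^ ℓ` is an integral power of `ℓ` smaller than `1`, so its exponent is at most `-1`.
  have hα0 : 1 ≤ (ℓ : ℝ) * α 0 := by
    obtain ⟨k, hk⟩ := (hρ 0).isLayerValue
    have h1 : ρ 0 ^ (ℓ ^ (0 + 1)) < 1 := pow_lt_one₀ (hρ 0).pos.le (hρ 0).lt_one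
      (pow_ne_zero _ hl.ne_zero)
    have h2 : k < 0 := by
      rw [hk, ← zpow_zero (ℓ : ℝ)] at h1
      exact (zpow_lt_zpow_iff_right₀ hl1).1 h1
    rw [zero_add, pow_one, hρα, ← Real.rpow_intCast] at hk
    have h3 := Real.rpow_le_rpow_left_iff hl1 |>.1 hk.le
    have h4 : (k : ℝ) ≤ -1 := by exact_mod_cast (by omega : k ≤ -1)
    linarith
  have hrec : ∀ n, (e : ℝ) ≤ ((ℓ : ℝ) - 1) * α (n + 1) ∨
      α n + min ((ℓ : ℝ) * ((ℓ : ℝ) - 1) * α n) e ≤ (ℓ : ℝ) * α (n + 1) := by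
    intro n
    by_cases hlt : ‖(ℓ : F)‖ < ρ (n + 1) ^ (ℓ - 1)
    · right
      have h1 := T.contraction_pow_le (hρ n) (hρ (n + 1)) hlt
      have h2 : ρ n = (ℓ : ℝ) ^ (-α n) := by
        have := hρα n 1
        rwa [pow_one, Nat.cast_one, one_mul] at this
      rw [hρα, hρα, hq, Nat.cast_mul, hcast] at h1
      rcases max_cases ((ℓ : ℝ) ^ (-((ℓ : ℝ) * ((ℓ : ℝ) - 1) * α n))) ((ℓ : ℝ) ^ (-(e : ℝ)))
        with ⟨h3, _⟩ | ⟨h3, _⟩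
      · rw [h3, h2, ← Real.rpow_add hl0, Real.rpow_le_rpow_left_iff hl1] at h1
        linarith [min_le_left ((ℓ : ℝ) * ((ℓ : ℝ) - 1) * α n) (e : ℝ)]
      · rw [h3, h2, ← Real.rpow_add hl0, Real.rpow_le_rpow_left_iff hl1] at h1
        linarith [min_le_right ((ℓ : ℝ) * ((ℓ : ℝ) - 1) * α n) (e : ℝ)]
    · left
      rw [not_lt, hρα, hq, Real.rpow_le_rpow_left_iff hl1, hcast] at hlt
      linarith
  have hsum := sum_ramification_deficit_le (by exact_mod_cast hl.two_le)
    (by exact_mod_cast T.index_pos) α hα0 hrec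
  set δ : ℕ → ℝ := fun n => max 0 ((e : ℝ) - ((ℓ : ℝ) - 1) * α n) with hδ
  have hδρ : ∀ n, ‖(ℓ : F)‖⁻¹ * max (ρ n ^ (ℓ - 1)) ‖(ℓ : F)‖ ≤ (ℓ : ℝ) ^ δ n := by
    intro n
    rw [hq, hρα, hcast, ← Real.rpow_neg hl0.le, neg_neg, mul_max_of_nonneg _ _ (by positivity),
      ← Real.rpow_add hl0, ← Real.rpow_add hl0]
    refine max_le ?_ ?_
    · rw [Real.rpow_le_rpow_left_iff hl1]
      exact (le_of_eq (by ring)).trans (le_max_right _ _)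
    · rw [Real.rpow_le_rpow_left_iff hl1, add_neg_cancel]
      exact le_max_left _ _
  -- The bottom step costs `e` whatever `ρ 0` is, so the deficits are counted from index `1`. By the
  -- ultrametric inequality the successive displacements contribute a maximum, not a sum.
  have main : ∀ n, ∀ x ∈ fixedLayer σ ℓ (n + 1),
      ‖x - ((ℓ : F) ^ (n + 1))⁻¹ * ∑ i ∈ Finset.range (ℓ ^ (n + 1)), (σ ^ i) x‖ ≤
        (ℓ : ℝ) ^ (e + ∑ i ∈ Finset.range n, δ (i + 1)) * ‖x - σ x‖ := by
    intro n
    induction n with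
    | zero =>
      intro x hx
      have := T.norm_sub_trace_step 0 x
      simp only [zero_add, pow_one, Finset.range_zero, Finset.sum_empty, add_zero]
      rwa [hq, ← Real.rpow_neg hl0.le, neg_neg, pow_zero, pow_one] at this
    | succ n ih =>
      intro x hx
      set y := (ℓ : F)⁻¹ * ∑ i ∈ Finset.range ℓ, ((σ ^ ℓ ^ (n + 1)) ^ i) x with hy
      have hyM : y ∈ fixedLayer σ ℓ (n + 1) := by
        refine mul_mem (inv_mem (natCast_mem _ ℓ)) ?_
        exact map_sum_range_pow (by rw [← pow_mul, ← pow_succ]; exact hx)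
      have htr : ((ℓ : F) ^ (n + 1 + 1))⁻¹ * ∑ i ∈ Finset.range (ℓ ^ (n + 1 + 1)), (σ ^ i) x
          = ((ℓ : F) ^ (n + 1))⁻¹ * ∑ i ∈ Finset.range (ℓ ^ (n + 1)), (σ ^ i) y := by
        rw [pow_succ ℓ (n + 1), RingHom.sum_range_pow_mul]
        simp_rw [hy, map_mul, map_inv₀, map_natCast]
        rw [← Finset.mul_sum, ← mul_assoc, ← mul_inv, ← pow_succ]
      have h1 := T.norm_sub_trace_step (n + 1) x
      have h2 := T.norm_trace_step_sub (hρ (n + 1)) hx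
      rw [← hy] at h1 h2
      have h3 := ih y hyM
      rw [htr, ← sub_add_sub_cancel x y, Finset.sum_range_succ]
      refine norm_add_le_of_ultrametric (h1.trans ?_) (h3.trans ?_)
      · refine mul_le_mul_of_nonneg_right ?_ (norm_nonneg _)
        rw [hq, ← Real.rpow_neg hl0.le, neg_neg, Real.rpow_le_rpow_left_iff hl1]
        have : 0 ≤ ∑ i ∈ Finset.range n, δ (i + 1) :=
          Finset.sum_nonneg fun i _ => le_max_left _ _
        have : 0 ≤ δ (n + 1) := le_max_left _ _
        linarith
      · rw [← add_assoc, Real.rpow_add hl0 _ (δ (n + 1)), mul_assoc]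
        refine mul_le_mul_of_nonneg_left (h2.trans ?_) (by positivity)
        exact mul_le_mul_of_nonneg_right (hδρ _) (norm_nonneg _)
  cases n with
  | zero =>
    simp only [pow_zero, inv_one, one_mul, Finset.sum_range_one, RingHom.one_def, RingHom.id_apply,
      sub_self, norm_zero]
    positivity
  | succ n =>
    refine (main n x hx).trans (mul_le_mul_of_nonneg_right ?_ (norm_nonneg _))
    rw [Real.rpow_le_rpow_left_iff hl1]
    linarith [hsum n]

end IsRamifiedTower

/-! ### Galois theory of the `ℤ_ℓ`-extension. -/

section GaloisTower

/-- By Artin's theorem the finite group generated by `g` is the whole Galois group, since its fixed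
field is the base. -/
theorem algebraMap_trace_eq_sum_range_pow {K N : Type*} [Field K] [Field N] [Algebra K N]
    (g : N ≃ₐ[K] N) (hfix : ∀ x, g x = x → ∃ k, algebraMap K N k = x) (hg : IsOfFinOrder g) (x : N) :
    algebraMap K N (Algebra.trace K N x) = ∑ i ∈ Finset.range (orderOf g), (g ^ i) x := by
  classical
  have hfin : Finite (Subgroup.zpowers g) := (finite_zpowers.2 hg).to_subtype
  have hGal : IsGaloisGroup (Subgroup.zpowers g) K N :=
    { faithful := inferInstance
      commutes := inferInstance
      isInvariant := ⟨fun y hy => hfix y (hy ⟨g, Subgroup.mem_zpowers g⟩)⟩ }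
  have := IsGaloisGroup.isGalois (Subgroup.zpowers g) K N
  have := IsGaloisGroup.finiteDimensional (Subgroup.zpowers g) K N
  have := Fintype.ofFinite (Subgroup.zpowers g)
  rw [trace_eq_sum_automorphisms,
    ← Equiv.sum_comp (IsGaloisGroup.mulEquivAlgEquiv (Subgroup.zpowers g) K N).toEquiv,
    ← Equiv.sum_comp (finEquivZPowers hg), ← Fin.sum_univ_eq_sum_range (fun i => (g ^ i) x)]
  rfl

variable {K L : Type*} [Field K] [Field L] [Algebra K L]

theorem AlgEquiv.toRingHom_pow_apply (σ : L ≃ₐ[K] L) (k : ℕ) (x : L) :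
    ((σ : L →+* L) ^ k) x = (σ ^ k) x := by
  induction k with
  | zero => simp
  | succ k ih => rw [pow_succ', pow_succ', RingHom.mul_def, RingHom.comp_apply, ih]; rfl

variable {ℓ : ℕ}

theorem norm_toAdd_le_of_mem_closure [Fact ℓ.Prime]
    (ψ : (L ≃ₐ[K] L) ≃ₜ* Multiplicative ℤ_[ℓ]) {τ : L ≃ₐ[K] L}
    {g : L ≃ₐ[K] L} (hg : g ∈ (Subgroup.zpowers τ).topologicalClosure) :
    ‖(ψ g).toAdd‖ ≤ ‖(ψ τ).toAdd‖ := by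
  let U : Subgroup (L ≃ₐ[K] L) :=
    { carrier := {g | ‖(ψ g).toAdd‖ ≤ ‖(ψ τ).toAdd‖}
      mul_mem' := fun {a b} ha hb => by
        simp only [Set.mem_ofPred_eq, map_mul, toAdd_mul] at *
        exact (PadicInt.nonarchimedean _ _).trans (max_le ha hb)
      one_mem' := by simp
      inv_mem' := fun {a} ha => by simpa using ha }
  have hU : IsClosed (U : Set (L ≃ₐ[K] L)) :=
    isClosed_le ((continuous_toAdd.comp ψ.continuous).norm) continuous_const
  exact Subgroup.topologicalClosure_minimal _
    ((Subgroup.zpowers_le).2 (le_refl ‖(ψ τ).toAdd‖)) hU hg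

variable [IsGalois K L] {σ : L ≃ₐ[K] L}

/-- Commutativity makes the `τ` whose `k`-th power fixes `x` a subgroup. It is closed, as
stabilizers are, and contains `σ`. -/
theorem pow_apply_eq_of_topologicalClosure_eq_top (hcomm : ∀ g h : L ≃ₐ[K] L, g * h = h * g)
    (hσ : (Subgroup.zpowers σ).topologicalClosure = ⊤) {k : ℕ} {x : L} (hx : (σ ^ k) x = x)
    (τ : L ≃ₐ[K] L) : (τ ^ k) x = x := by
  let S := MulAction.stabilizer (L ≃ₐ[K] L) x
  have hS : IsClosed (S : Set (L ≃ₐ[K] L)) :=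
    Subgroup.isClosed_of_isOpen S (stabilizer_isOpen_of_isIntegral x)
  let T : Subgroup (L ≃ₐ[K] L) :=
    { carrier := {τ | τ ^ k ∈ S}
      mul_mem' := fun {a b} ha hb => by
        simp only [Set.mem_ofPred_eq] at *
        rw [(show Commute a b from hcomm a b).mul_pow]
        exact mul_mem ha hb
      one_mem' := by simp
      inv_mem' := fun {a} ha => by
        simp only [Set.mem_ofPred_eq] at *
        rw [inv_pow]
        exact inv_mem ha }
  have hT : IsClosed (T : Set (L ≃ₐ[K] L)) := hS.preimage (continuous_pow k)
  have hle : (Subgroup.zpowers σ).topologicalClosure ≤ T :=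
    Subgroup.topologicalClosure_minimal _ ((Subgroup.zpowers_le).2 hx) hT
  rw [hσ] at hle
  exact hle (Subgroup.mem_top τ)

theorem exists_algebraMap_eq_of_apply_eq (hcomm : ∀ g h : L ≃ₐ[K] L, g * h = h * g)
    (hσ : (Subgroup.zpowers σ).topologicalClosure = ⊤) {x : L} (hx : σ x = x) :
    ∃ k, algebraMap K L k = x := by
  refine (InfiniteGalois.mem_range_algebraMap_iff_fixed x).2 fun τ => ?_
  have := pow_apply_eq_of_topologicalClosure_eq_top hcomm hσ (k := 1) (by rwa [pow_one]) τ
  rwa [pow_one] at this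

theorem mem_layer_iff {K L : Type*} [NormedField K] [Field L] [Algebra K L] [IsGalois K L]
    {σ : L ≃ₐ[K] L} (hcomm : ∀ g h : L ≃ₐ[K] L, g * h = h * g)
    (hσ : (Subgroup.zpowers σ).topologicalClosure = ⊤) {n : ℕ} {x : L} :
    x ∈ layer K L ℓ n ↔ (σ ^ ℓ ^ n) x = x := by
  rw [layer, IntermediateField.mem_fixedField_iff]
  constructor
  · intro h
    exact h _ (Subgroup.subset_closure ⟨σ, rfl⟩)
  · intro h
    have : Subgroup.closure (Set.range fun τ : L ≃ₐ[K] L => τ ^ ℓ ^ n) ≤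
        MulAction.stabilizer (L ≃ₐ[K] L) x := by
      rw [Subgroup.closure_le]
      rintro _ ⟨τ, rfl⟩
      exact pow_apply_eq_of_topologicalClosure_eq_top hcomm hσ h τ
    exact fun f hf => this hf

section PadicInt

variable [Fact ℓ.Prime]

theorem exists_pow_apply_eq (ψ : (L ≃ₐ[K] L) ≃ₜ* Multiplicative ℤ_[ℓ]) (σ : L ≃ₐ[K] L) (x : L) :
    ∃ n : ℕ, (σ ^ ℓ ^ n) x = x := by
  have hlt : ‖(ℓ : ℤ_[ℓ])‖ < 1 := by
    rw [PadicInt.norm_p]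
    exact inv_lt_one_of_one_lt₀ (by exact_mod_cast (Fact.out : ℓ.Prime).one_lt)
  have hopen := stabilizer_isOpen_of_isIntegral (K := K) x
  have htend : Filter.Tendsto (fun n : ℕ => σ ^ ℓ ^ n) Filter.atTop (nhds 1) := by
    have h1 : Filter.Tendsto (fun n : ℕ => (ℓ : ℤ_[ℓ]) ^ n * (ψ σ).toAdd) Filter.atTop (nhds 0) := by
      have := (tendsto_pow_atTop_nhds_zero_of_norm_lt_one (R := ℤ_[ℓ]) (x := ℓ) hlt).mul_const
        (ψ σ).toAdd
      rwa [zero_mul] at this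
    have h2 : Filter.Tendsto (fun n : ℕ => ψ.symm (Multiplicative.ofAdd
        ((ℓ : ℤ_[ℓ]) ^ n * (ψ σ).toAdd))) Filter.atTop (nhds (ψ.symm (Multiplicative.ofAdd 0))) :=
      (ψ.symm.continuous.tendsto _).comp ((continuous_ofAdd.tendsto _).comp h1)
    rw [ofAdd_zero, map_one] at h2
    refine h2.congr fun n => ?_
    rw [← ψ.injective.eq_iff, map_pow, ContinuousMulEquiv.apply_symm_apply,
      ← Multiplicative.toAdd.injective.eq_iff, toAdd_pow, toAdd_ofAdd, nsmul_eq_mul, Nat.cast_pow]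
  have := htend.eventually (hopen.mem_nhds (one_mem (MulAction.stabilizer (L ≃ₐ[K] L) x)))
  exact this.exists

/-- If the layers coincided, the infinite Galois correspondence would put `σ ^ ℓ ^ n` in the closure
of the group generated by `σ ^ ℓ ^ (n + 1)`. Closed balls of `ℤ_[ℓ]` are closed subgroups, so
`ℓ`-adic norms forbid this. -/
theorem exists_pow_apply_ne (ψ : (L ≃ₐ[K] L) ≃ₜ* Multiplicative ℤ_[ℓ])
    (hσ : (Subgroup.zpowers σ).topologicalClosure = ⊤) (n : ℕ) :
    ∃ x, (σ ^ ℓ ^ (n + 1)) x = x ∧ (σ ^ ℓ ^ n) x ≠ x := by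
  have hl := (Fact.out : ℓ.Prime)
  by_contra! hc
  let H : ClosedSubgroup (L ≃ₐ[K] L) :=
    ⟨(Subgroup.zpowers (σ ^ ℓ ^ (n + 1))).topologicalClosure, Subgroup.isClosed_topologicalClosure _⟩
  have hmem : σ ^ ℓ ^ n ∈ (H : Subgroup (L ≃ₐ[K] L)) := by
    rw [← InfiniteGalois.fixingSubgroup_fixedField H, IntermediateField.mem_fixingSubgroup_iff]
    intro x hx
    refine hc x ((IntermediateField.mem_fixedField_iff _ _).1 hx _ ?_)
    exact Subgroup.le_topologicalClosure _ (Subgroup.mem_zpowers _)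
  have h1 := norm_toAdd_le_of_mem_closure ψ hmem
  have hψ : ∀ k, ‖(ψ (σ ^ ℓ ^ k)).toAdd‖ = (ℓ : ℝ)⁻¹ ^ k * ‖(ψ σ).toAdd‖ := by
    intro k
    rw [map_pow, toAdd_pow, nsmul_eq_mul, norm_mul, Nat.cast_pow, norm_pow, PadicInt.norm_p]
  have h2 : 1 ≤ ‖(ψ σ).toAdd‖ := by
    have := norm_toAdd_le_of_mem_closure ψ (τ := σ) (g := ψ.symm (Multiplicative.ofAdd 1))
      (by rw [hσ]; exact Subgroup.mem_top _)
    simpa using this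
  rw [hψ, hψ, pow_succ] at h1
  have hl1 : (1 : ℝ) < ℓ := by exact_mod_cast hl.one_lt
  have h3 : (ℓ : ℝ)⁻¹ < 1 := inv_lt_one_of_one_lt₀ hl1
  have h4 : 0 < (ℓ : ℝ)⁻¹ ^ n := by positivity
  have h5 := le_of_mul_le_mul_right h1 (by linarith)
  nlinarith

end PadicInt

section Trace

variable {K L : Type*} [NormedField K] [Field L] [Algebra K L] [IsGalois K L] [Fact ℓ.Prime]
    {σ : L ≃ₐ[K] L}

theorem algebraMap_trace_layer (ψ : (L ≃ₐ[K] L) ≃ₜ* Multiplicative ℤ_[ℓ])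
    (hcomm : ∀ g h : L ≃ₐ[K] L, g * h = h * g)
    (hσ : (Subgroup.zpowers σ).topologicalClosure = ⊤) (n : ℕ) (x : layer K L ℓ n) :
    algebraMap K L (Algebra.trace K (layer K L ℓ n) x) =
      ∑ i ∈ Finset.range (ℓ ^ n), (σ ^ i) (x : L) := by
  have hl := (Fact.out : ℓ.Prime)
  have hstab : ∀ (τ : L ≃ₐ[K] L), ∀ y ∈ layer K L ℓ n, τ y ∈ layer K L ℓ n := by
    intro τ y hy
    rw [mem_layer_iff hcomm hσ] at *
    rw [← AlgEquiv.mul_apply, hcomm, AlgEquiv.mul_apply, hy]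
  let f : layer K L ℓ n →ₐ[K] layer K L ℓ n :=
    ((σ : L →ₐ[K] L).comp (layer K L ℓ n).val).codRestrict (layer K L ℓ n).toSubalgebra
      fun y => hstab σ y y.2
  have hf : ∀ y, ((f y : layer K L ℓ n) : L) = σ (y : L) := fun y => rfl
  let g : layer K L ℓ n ≃ₐ[K] layer K L ℓ n := AlgEquiv.ofBijective f ⟨f.injective, fun y =>
    ⟨⟨σ.symm y, hstab σ.symm y y.2⟩, Subtype.ext (by rw [hf]; simp)⟩⟩
  have hg : ∀ (i : ℕ) y, (((g ^ i) y : layer K L ℓ n) : L) = (σ ^ i) (y : L) := by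
    intro i
    induction i with
    | zero => intro y; simp
    | succ i ih =>
      intro y
      rw [pow_succ', pow_succ', AlgEquiv.mul_apply, AlgEquiv.mul_apply, ← ih]
      exact hf _
  have hpow : g ^ ℓ ^ n = 1 := by
    ext y
    rw [hg, AlgEquiv.one_apply]
    exact (mem_layer_iff hcomm hσ).1 y.2
  have hord : orderOf g = ℓ ^ n := by
    cases n with
    | zero => simpa using hpow
    | succ n =>
      refine orderOf_eq_prime_pow (fun h => ?_) hpow
      obtain ⟨y, hy, hyn⟩ := exists_pow_apply_ne ψ hσ n
      apply hyn
      have := hg (ℓ ^ n) ⟨y, (mem_layer_iff hcomm hσ).2 hy⟩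
      rw [h] at this
      exact this.symm
  have hfin : IsOfFinOrder g := isOfFinOrder_iff_pow_eq_one.2 ⟨ℓ ^ n, pow_pos hl.pos n, hpow⟩
  have h := algebraMap_trace_eq_sum_range_pow g (fun y hy => by
    obtain ⟨k, hk⟩ := exists_algebraMap_eq_of_apply_eq hcomm hσ (x := (y : L))
      (congrArg Subtype.val hy)
    exact ⟨k, Subtype.ext hk⟩) hfin x
  rw [hord] at h
  have h' := congrArg (algebraMap (layer K L ℓ n) L) h
  rw [← IsScalarTower.algebraMap_apply, map_sum] at h'
  rw [h']
  exact Finset.sum_congr rfl fun i _ => hg i x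

theorem normalizedTrace_eq [CharZero K] (ψ : (L ≃ₐ[K] L) ≃ₜ* Multiplicative ℤ_[ℓ])
    (hcomm : ∀ g h : L ≃ₐ[K] L, g * h = h * g)
    (hσ : (Subgroup.zpowers σ).topologicalClosure = ⊤) (n : ℕ) (x : layer K L ℓ n) :
    normalizedTrace K ℓ (x : L) = ((ℓ : K) ^ n)⁻¹ * Algebra.trace K (layer K L ℓ n) x := by
  classical
  have hl := (Fact.out : ℓ.Prime)
  have hex : ∃ n : ℕ, (x : L) ∈ layer K L ℓ n := ⟨n, x.2⟩
  rw [normalizedTrace, dif_pos hex]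
  obtain ⟨k, hk⟩ := Nat.exists_eq_add_of_le (Nat.find_min' hex x.2)
  have hm := (mem_layer_iff hcomm hσ).1 (Nat.find_spec hex)
  have hℓ : ℓ ^ n = ℓ ^ Nat.find hex * ℓ ^ k := by rw [← pow_add, ← hk]
  apply (algebraMap K L).injective
  rw [map_mul, map_mul, algebraMap_trace_layer ψ hcomm hσ, algebraMap_trace_layer ψ hcomm hσ]
  -- The orbit sum runs `ℓ ^ k` times through the one of the least layer, which the normalizing
  -- factor compensates.
  have h1 : ∑ i ∈ Finset.range (ℓ ^ n), (σ ^ i) (x : L)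
      = (ℓ : L) ^ k * ∑ i ∈ Finset.range (ℓ ^ Nat.find hex), (σ ^ i) (x : L) := by
    simp_rw [← AlgEquiv.toRingHom_pow_apply]
    rw [hℓ, RingHom.sum_range_pow_mul, Finset.mul_sum]
    refine Finset.sum_congr rfl fun i _ => ?_
    have h2 : ∀ j, (((σ : L →+* L) ^ ℓ ^ Nat.find hex) ^ j) (x : L) = x := fun j =>
      RingHom.pow_apply_eq_self (by rw [AlgEquiv.toRingHom_pow_apply, hm]) j
    simp_rw [h2]
    rw [Finset.sum_const, Finset.card_range, nsmul_eq_mul, map_mul, map_natCast, Nat.cast_pow]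
  rw [h1]
  have hc : (ℓ : L) ≠ 0 := by
    rw [← map_natCast (algebraMap K L)]
    exact (map_ne_zero _).2 (by exact_mod_cast hl.ne_zero)
  have hℓL : (ℓ : L) ^ n = ℓ ^ Nat.find hex * ℓ ^ k := by exact_mod_cast congrArg (Nat.cast : ℕ → L) hℓ
  simp only [map_inv₀, map_pow, map_natCast]
  rw [hℓL]
  field_simp

end Trace

end GaloisTower

/-! ### The numerical bound and the main theorem. -/

theorem IsNormalizedLocalField.norm_natCast_lt_one {ℓ : ℕ} {K : Type*} [NormedField K]
    [IsUltrametricDist K] (hK : IsNormalizedLocalField ℓ K) (hℓ : (ℓ : K) ≠ 0) : ‖(ℓ : K)‖ < 1 := by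
  have := hK.residue_char
  refine (norm_natCast_le_one_of_ultrametric ℓ).lt_of_ne fun h => ?_
  have hmem : (ℓ : K)⁻¹ ∈ integerRing K := by
    rw [Valuation.mem_valuationSubring_iff]
    change ‖(ℓ : K)⁻¹‖₊ ≤ 1
    rw [nnnorm_inv, inv_le_one₀] <;> simp [← NNReal.coe_le_coe, h, hℓ]
  have h1 : (ℓ : integerRing K) * ⟨_, hmem⟩ = 1 := Subtype.ext (by
    push_cast
    exact mul_inv_cancel₀ hℓ)
  have h2 := congrArg (IsLocalRing.residue (integerRing K)) h1
  rw [map_mul, map_natCast, CharP.cast_eq_zero, zero_mul, map_one] at h2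
  exact zero_ne_one h2

theorem ramificationBound_le {p e : ℝ} (hp : 2 ≤ p) (he : 1 ≤ e) :
    2 * p / (p - 1) ^ 2 * e ^ 2 + e + 1 / (p * (p - 1)) ≤ 6 * e ^ 2 := by
  have h1 : 2 * p / (p - 1) ^ 2 ≤ 4 := by
    rw [div_le_iff₀ (by nlinarith)]
    nlinarith
  have h2 : 1 / (p * (p - 1)) ≤ 1 := by
    rw [div_le_one (by nlinarith)]
    nlinarith
  have h3 : 2 * p / (p - 1) ^ 2 * e ^ 2 ≤ 4 * e ^ 2 := mul_le_mul_of_nonneg_right h1 (by positivity)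
  nlinarith

theorem mainTheorem5 (ℓ : ℕ) [Fact ℓ.Prime]
    (K : Type*) [NormedField K] [IsUltrametricDist K] [CharZero K]
    (hK : IsNormalizedLocalField ℓ K)
    -- the absolute ramification index `e = v(ℓ)`
    (e : ℕ) (he : ‖(ℓ : K)‖ = (ℓ : ℝ) ^ (-(e : ℤ)))
    (L : Type*) [Field L] [Algebra K L] [IsGalois K L]
    (hGal : Nonempty ((L ≃ₐ[K] L) ≃ₜ* Multiplicative ℤ_[ℓ]))
    (hram : IsTotallyRamifiedExt K L)
    (σ : L ≃ₐ[K] L) (hσ : (Subgroup.zpowers σ).topologicalClosure = ⊤) :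
    -- `t` is well defined on `L`, as the union of the `K_n`
    (∀ x : L, ∃ n : ℕ, x ∈ layer K L ℓ n) ∧
    (∀ (n : ℕ) (x : layer K L ℓ n), normalizedTrace K ℓ (x : L) =
      ((ℓ : K) ^ n)⁻¹ * Algebra.trace K (layer K L ℓ n) x) ∧
    -- the inequality
    ∃ c₅ : ℝ,
      |c₅| ≤ 2 * (ℓ : ℝ) / ((ℓ : ℝ) - 1) ^ 2 * (e : ℝ) ^ 2 + (e : ℝ)
        + 1 / ((ℓ : ℝ) * ((ℓ : ℝ) - 1)) ∧
      2 * (ℓ : ℝ) / ((ℓ : ℝ) - 1) ^ 2 * (e : ℝ) ^ 2 + (e : ℝ)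
        + 1 / ((ℓ : ℝ) * ((ℓ : ℝ) - 1)) ≤ 6 * (e : ℝ) ^ 2 ∧
      ∀ x : L, spectralNorm K L (x - algebraMap K L (normalizedTrace K ℓ x)) ≤
        (ℓ : ℝ) ^ c₅ * spectralNorm K L (x - σ x) := by
  have hl := (Fact.out : ℓ.Prime)
  have hl2 : (2 : ℝ) ≤ ℓ := by exact_mod_cast hl.two_le
  have hℓ0 : (ℓ : K) ≠ 0 := by exact_mod_cast hl.ne_zero
  obtain ⟨ψ⟩ := hGal
  have hcomm : ∀ g h : L ≃ₐ[K] L, g * h = h * g := fun g h => by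
    apply ψ.injective
    rw [map_mul, map_mul, mul_comm]
  have hunion : ∀ x : L, ∃ n : ℕ, x ∈ layer K L ℓ n := fun x => by
    obtain ⟨n, hn⟩ := exists_pow_apply_eq ψ σ x
    exact ⟨n, (mem_layer_iff hcomm hσ).2 hn⟩
  have htr := fun n x => normalizedTrace_eq ψ hcomm hσ n x
  have hepos : 0 < e := by
    refine Nat.pos_of_ne_zero fun h0 => ?_
    have := hK.norm_natCast_lt_one hℓ0
    rw [he, h0] at this
    simp at this
  have he1 : (1 : ℝ) ≤ e := by exact_mod_cast hepos
  -- The tower estimate gives this constant directly; the term `1 / (ℓ (ℓ - 1))` of the bound is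
  -- slack.
  refine ⟨hunion, htr, e + 2 * (ℓ : ℝ) / ((ℓ : ℝ) - 1) ^ 2 * (e : ℝ) ^ 2, ?_,
    ramificationBound_le hl2 he1, ?_⟩
  · have h1 : 0 ≤ 1 / ((ℓ : ℝ) * ((ℓ : ℝ) - 1)) :=
      div_nonneg zero_le_one (mul_nonneg (by linarith) (by linarith))
    rw [abs_of_nonneg (by positivity)]
    linarith
  have : CompleteSpace K := hK.complete
  -- The norm is the given one; the uniformizer only shows that it is nontrivial, so that `L` can be
  -- normed by `spectralNorm`.
  let : NontriviallyNormedField K :=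
    { ‹NormedField K› with
      non_trivial := by
        obtain ⟨ϖ, hϖ⟩ := hK.exists_uniformizer
        refine ⟨ϖ⁻¹, ?_⟩
        rw [norm_inv, hϖ, inv_inv]
        linarith }
  let : NormedField L := spectralNorm.normedField K L
  have hnorm : ∀ x : L, ‖x‖ = spectralNorm K L x := fun x => rfl
  have hult : IsUltrametricDist L :=
    IsUltrametricDist.isUltrametricDist_of_isNonarchimedean_norm isNonarchimedean_spectralNorm
  have hmem : ∀ {n : ℕ} {x : L}, x ∈ fixedLayer (σ : L →+* L) ℓ n ↔ (σ ^ ℓ ^ n) x = x := by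
    intro n x
    rw [mem_fixedLayer, AlgEquiv.toRingHom_pow_apply]
  have T : IsRamifiedTower ℓ e (σ : L →+* L) :=
    { isometry := fun x => (spectralNorm_eq_of_equiv σ x).symm
      norm_eq_zpow := fun x hx hx0 => by
        obtain ⟨k, rfl⟩ := exists_algebraMap_eq_of_apply_eq hcomm hσ hx
        rw [hnorm, spectralNorm_extends]
        exact hK.norm_eq_zpow k (by rintro rfl; simp at hx0)
      exists_uniformizer := by
        obtain ⟨ϖ, hϖ⟩ := hK.exists_uniformizer
        exact ⟨algebraMap K L ϖ, σ.commutes ϖ, by rw [hnorm, spectralNorm_extends, hϖ]⟩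
      exists_residue := fun x hx => by
        obtain ⟨y, hy⟩ := hram x hx
        exact ⟨algebraMap K L y, σ.commutes y, hy⟩
      strict := fun n => by
        obtain ⟨x, hx, hxn⟩ := exists_pow_apply_ne ψ hσ n
        exact ⟨x, hmem.2 hx, fun h => hxn (hmem.1 h)⟩
      norm_natCast := by
        rw [← map_natCast (algebraMap K L), hnorm, spectralNorm_extends, he]
      index_pos := hepos }
  intro x
  obtain ⟨n, hn⟩ := hunion x
  have h := T.norm_sub_normalizedTrace_le n (hmem.2 ((mem_layer_iff hcomm hσ).1 hn))
  have e1 : algebraMap K L (normalizedTrace K ℓ x)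
      = ((ℓ : L) ^ n)⁻¹ * ∑ i ∈ Finset.range (ℓ ^ n), ((σ : L →+* L) ^ i) x := by
    rw [htr n ⟨x, hn⟩, map_mul, algebraMap_trace_layer ψ hcomm hσ]
    simp_rw [AlgEquiv.toRingHom_pow_apply]
    simp
  rw [e1]
  exact h
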